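/- **Conventions.** Let $A$ be a C$^*$-algebra and $\mathbb{R}^+=[0,\infty)$; "decreasing" means non-increasing. $P_\infty(A)$ denotes the set of projections in the matrix algebras $M_n(A)$, $n\ge 1$, and $p\sim q$ is Murray–von Neumann equivalence ($p=v^*v$, $q=vv^*$ for a rectangular matrix $v$ over $A$). $K_0(A)$ is preordered by its positive cone $K_0(A)^+=\{[p]_0 : p\in P_\infty(A)\}$. $A$ has *cancellation* if, for all $p,q\in P_\infty(A)$, $[p]_0=[q]_0$ if and only if $p\sim q$. The ordered group $K_0(A)$ is *simple* if its only order ideals are $0$ and $K_0(A)$. $A$ is *stable* if $A\cong A\otimes\mathcal{K}$, with $\mathcal K$ the compact operators on a separable infinite-dimensional Hilbert space. $A$ has *real rank zero* if the invertible self-adjoint elements of the unitization of $A$ are dense in its self-adjoint elements. For $a\in A$ the *singular value function* $s(a)\colon K_0(A)^+\to\mathbb{R}^+$ is $$s_g(a)=\inf\{\|a-ap\| : p\in A \text{ a projection},\ [p]_0\le g\},\qquad g\in K_0(A)^+ .$$ A function $f\colon K_0(A)^+\to\mathbb{R}^+$ *vanishes at infinity* if for every $\varepsilon>0$ there is $x\in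 K_0(A)^+$ with $f(y)<\varepsilon$ for all $y\ge x$ in $K_0(A)^+$. For $S\subset\mathbb{R}^+$ with $0\in S$ and a decreasing function $f\colon S\to\mathbb{R}^+$ that is right-continuous for the relative topology, put $f(x+)=\sup f((x,\infty)\cap S)$ and, for $x\neq0$, $f(x-)=\inf f([0,x)\cap S)$. Define $\overline f\colon\overline S\to\mathbb{R}^+$ on the closure of $S$ by $\overline f(x)=f(x)$ if $x\in S$, $\overline f(x)=f(x+)$ if $x\in\overline S\setminus S$ is a right accumulation point of $S$, and $\overline f(x)=f(x-)$ otherwise, and let $$DP(\overline f)=\{x\in\overline S\setminus\{0\} : \overline f(x-)>\overline f(x)\},\qquad \overline f(x-)=\inf \overline f([0,x)\cap\overline S).$$ **Theorem.** Let $A$ be a C$^*$-algebra with cancellation such that the ordered group $K_0(A)$ is simple and totally ordered. Then $(K_0(A),K_0(A)^+)$ embeds into $(\mathbb{R},\mathbb{R}^+)$ as an ordered group (that is, by an injective homomorphism $\iota$ such that $\iota(g)\ge0$ if and only if $g\in K_0(A)^+$). Fix any such embedding and regard $K_0(A)^+$ as a subset of $\mathbb{R}^+$. If $A$ is unital (respectively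 stable), then the following hold. 1. Let $f\colon K_0(A)^+\to\mathbb{R}^+$ be a decreasing, right-continuous function such that $DP(\overline f)\subset K_0(A)^+$ and $f([1_A]_0)=0$ (respectively, $f$ vanishes at infinity). Then there exists $a\in A$ with $f=s(a)$. 2. If $A$ has real rank zero, then for every $a\in A$ the function $s(a)$ is right-continuous and vanishes at infinity, and $DP(\overline{s(a)})\subset K_0(A)^+$. -/

import Mathlib

open scoped NNReal Matrix

noncomputable section

namespace SVF

/-! ### Projections in matrix algebras and Murray-von Neumann equivalence -/

section Proj

variable {B C : Type*} [NonUnitalRing B] [StarRing B] [NonUnitalRing C] [StarRing C]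

/-- Murray-von Neumann equivalence of square matrices of possibly different sizes:
`p = v* v` and `q = v v*` for some rectangular matrix `v` over the algebra. -/
def MvN {m n : Type*} [Fintype m] [Fintype n] (p : Matrix m m B) (q : Matrix n n B) : Prop :=
  ∃ v : Matrix n m B, vᴴ * v = p ∧ v * vᴴ = q

/-- The block diagonal sum `p ⊕ q`, as a matrix indexed by `Fin (m + n)`. -/
def dsum {m n : ℕ} (p : Matrix (Fin m) (Fin m) B) (q : Matrix (Fin n) (Fin n) B) :
    Matrix (Fin (m + n)) (Fin (m + n)) B :=
  Matrix.reindex finSumFinEquiv finSumFinEquiv (Matrix.fromBlocks p 0 0 q)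

variable (B) in
/-- `P_∞(B)`: the projections in all the matrix algebras `M_n(B)`. -/
def ProjInf : Type _ := Σ n : ℕ, {p : Matrix (Fin n) (Fin n) B // IsStarProjection p}

theorem isStarProjection_iff_conj {n : Type*} [Fintype n] {p : Matrix n n B} :
    IsStarProjection p ↔ p * p = p ∧ pᴴ = p := isStarProjection_iff'

theorem MvN.refl {n : Type*} [Fintype n] {p : Matrix n n B} (hp : IsStarProjection p) :
    MvN p p := by
  obtain ⟨h1, h2⟩ := isStarProjection_iff_conj.1 hp
  exact ⟨p, by rw [h2, h1], by rw [h2, h1]⟩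

theorem MvN.symm {m n : Type*} [Fintype m] [Fintype n] {p : Matrix m m B} {q : Matrix n n B}
    (h : MvN p q) : MvN q p := by
  obtain ⟨v, h1, h2⟩ := h
  exact ⟨vᴴ, by rw [Matrix.conjTranspose_conjTranspose, h2],
    by rw [Matrix.conjTranspose_conjTranspose, h1]⟩

theorem MvN.trans {l m n : Type*} [Fintype l] [Fintype m] [Fintype n] {p : Matrix l l B}
    {q : Matrix m m B} {r : Matrix n n B} (hp : IsStarProjection p) (hr : IsStarProjection r)
    (h : MvN p q) (h' : MvN q r) : MvN p r := by
  obtain ⟨v, h1, h2⟩ := h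
  obtain ⟨w, h3, h4⟩ := h'
  have hp' := (isStarProjection_iff_conj.1 hp).1
  have hr' := (isStarProjection_iff_conj.1 hr).1
  refine ⟨w * v, ?_, ?_⟩
  · calc (w * v)ᴴ * (w * v) = vᴴ * (wᴴ * w) * v := by
          simp only [Matrix.conjTranspose_mul, Matrix.mul_assoc]
      _ = (vᴴ * v) * (vᴴ * v) := by rw [h3, ← h2]; simp only [Matrix.mul_assoc]
      _ = p := by rw [h1, hp']
  · calc (w * v) * (w * v)ᴴ = w * (v * vᴴ) * wᴴ := by
          simp only [Matrix.conjTranspose_mul, Matrix.mul_assoc]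
      _ = (w * wᴴ) * (w * wᴴ) := by rw [h2, ← h3]; simp only [Matrix.mul_assoc]
      _ = r := by rw [h4, hr']

theorem isStarProjection_reindex {m n : Type*} [Fintype m] [Fintype n] (e : m ≃ n)
    {p : Matrix m m B} (hp : IsStarProjection p) :
    IsStarProjection (Matrix.reindex e e p) := by
  obtain ⟨h1, h2⟩ := isStarProjection_iff_conj.1 hp
  refine isStarProjection_iff_conj.2 ⟨?_, ?_⟩
  · rw [Matrix.reindex_apply, Matrix.submatrix_mul_equiv, h1]
  · rw [Matrix.conjTranspose_reindex, h2]

theorem mvN_reindex {m n : Type*} [Fintype m] [Fintype n] (e : m ≃ n)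
    {p : Matrix m m B} (hp : IsStarProjection p) : MvN p (Matrix.reindex e e p) := by
  obtain ⟨h1, h2⟩ := isStarProjection_iff_conj.1 hp
  refine ⟨p.submatrix e.symm (Equiv.refl m), ?_, ?_⟩
  · rw [Matrix.conjTranspose_submatrix, Matrix.submatrix_mul_equiv, h2, h1]; rfl
  · rw [Matrix.conjTranspose_submatrix, Matrix.submatrix_mul_equiv, h2, h1]; rfl

theorem isStarProjection_fromBlocks {m n : Type*} [Fintype m] [Fintype n]
    {p : Matrix m m B} {q : Matrix n n B} (hp : IsStarProjection p) (hq : IsStarProjection q) :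
    IsStarProjection (Matrix.fromBlocks p 0 0 q) := by
  obtain ⟨h1, h2⟩ := isStarProjection_iff_conj.1 hp
  obtain ⟨h3, h4⟩ := isStarProjection_iff_conj.1 hq
  refine isStarProjection_iff_conj.2 ⟨?_, ?_⟩
  · simp [Matrix.fromBlocks_multiply, h1, h3]
  · simp [Matrix.fromBlocks_conjTranspose, h2, h4]

theorem MvN.fromBlocks {m n m' n' : Type*} [Fintype m] [Fintype n] [Fintype m'] [Fintype n']
    {p : Matrix m m B} {q : Matrix n n B} {p' : Matrix m' m' B} {q' : Matrix n' n' B}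
    (h : MvN p p') (h' : MvN q q') :
    MvN (Matrix.fromBlocks p 0 0 q) (Matrix.fromBlocks p' 0 0 q') := by
  obtain ⟨v, h1, h2⟩ := h
  obtain ⟨w, h3, h4⟩ := h'
  exact ⟨Matrix.fromBlocks v 0 0 w,
    by simp [Matrix.fromBlocks_conjTranspose, Matrix.fromBlocks_multiply, h1, h3],
    by simp [Matrix.fromBlocks_conjTranspose, Matrix.fromBlocks_multiply, h2, h4]⟩

theorem isStarProjection_dsum {m n : ℕ} {p : Matrix (Fin m) (Fin m) B}
    {q : Matrix (Fin n) (Fin n) B} (hp : IsStarProjection p) (hq : IsStarProjection q) :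
    IsStarProjection (dsum p q) :=
  isStarProjection_reindex _ (isStarProjection_fromBlocks hp hq)

theorem mvN_dsum {m n : ℕ} {p : Matrix (Fin m) (Fin m) B}
    {q : Matrix (Fin n) (Fin n) B} (hp : IsStarProjection p) (hq : IsStarProjection q) :
    MvN (Matrix.fromBlocks p 0 0 q) (dsum p q) :=
  mvN_reindex _ (isStarProjection_fromBlocks hp hq)

theorem MvN.dsum {m n m' n' : ℕ} {p : Matrix (Fin m) (Fin m) B} {q : Matrix (Fin n) (Fin n) B}
    {p' : Matrix (Fin m') (Fin m') B} {q' : Matrix (Fin n') (Fin n') B}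
    (hp : IsStarProjection p) (hq : IsStarProjection q)
    (hp' : IsStarProjection p') (hq' : IsStarProjection q')
    (h : MvN p p') (h' : MvN q q') : MvN (dsum p q) (SVF.dsum p' q') :=
  MvN.trans (isStarProjection_dsum hp hq) (isStarProjection_dsum hp' hq') (mvN_dsum hp hq).symm
    (MvN.trans (isStarProjection_fromBlocks hp hq) (isStarProjection_dsum hp' hq')
      (h.fromBlocks h') (mvN_dsum hp' hq'))

theorem isStarProjection_map {n : Type*} [Fintype n] (φ : B →⋆ₙ+* C) {p : Matrix n n B}
    (hp : IsStarProjection p) : IsStarProjection (p.map φ) := by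
  obtain ⟨h1, h2⟩ := isStarProjection_iff_conj.1 hp
  refine isStarProjection_iff_conj.2 ⟨?_, ?_⟩
  · rw [← Matrix.map_mul, h1]
  · rw [← Matrix.conjTranspose_map _ (fun x => map_star φ x), h2]

theorem MvN.map {m n : Type*} [Fintype m] [Fintype n] (φ : B →⋆ₙ+* C)
    {p : Matrix m m B} {q : Matrix n n B} (h : MvN p q) : MvN (p.map φ) (q.map φ) := by
  obtain ⟨v, h1, h2⟩ := h
  refine ⟨v.map φ, ?_, ?_⟩
  · rw [← Matrix.conjTranspose_map _ (fun x => map_star φ x), ← Matrix.map_mul, h1]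
  · rw [← Matrix.conjTranspose_map _ (fun x => map_star φ x), ← Matrix.map_mul, h2]

theorem dsum_map {m n : ℕ} (φ : B →⋆ₙ+* C) (p : Matrix (Fin m) (Fin m) B)
    (q : Matrix (Fin n) (Fin n) B) : (dsum p q).map φ = dsum (p.map φ) (q.map φ) := by
  have h := Matrix.fromBlocks_map p 0 0 q φ
  rw [Matrix.map_zero _ (map_zero φ), Matrix.map_zero _ (map_zero φ)] at h
  rw [dsum, dsum, ← h]
  rfl

/-! ### The Murray-von Neumann monoid and its Grothendieck group -/

variable (B) in
/-- Murray-von Neumann equivalence on `P_∞(B)`. -/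
def projSetoid : Setoid (ProjInf B) where
  r p q := MvN p.2.1 q.2.1
  iseqv := ⟨fun p => MvN.refl p.2.2, fun h => h.symm,
    fun {p _ r} h h' => MvN.trans p.2.2 r.2.2 h h'⟩

variable (B) in
/-- The monoid `V(B)` of Murray-von Neumann classes of projections in matrices over `B`. -/
def V : Type _ := Quotient (projSetoid B)

/-- The class in `V(B)` of a projection in `M_n(B)`. -/
def V.mk {n : ℕ} (p : Matrix (Fin n) (Fin n) B) (hp : IsStarProjection p) : V B :=
  Quotient.mk (projSetoid B) ⟨n, p, hp⟩

theorem V.mk_eq_mk {m n : ℕ} {p : Matrix (Fin m) (Fin m) B} {q : Matrix (Fin n) (Fin n) B}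
    {hp : IsStarProjection p} {hq : IsStarProjection q} :
    V.mk p hp = V.mk q hq ↔ MvN p q :=
  Quotient.eq (r := projSetoid B)

theorem V.ind {motive : V B → Prop}
    (h : ∀ (n : ℕ) (p : Matrix (Fin n) (Fin n) B) (hp : IsStarProjection p),
      motive (V.mk p hp)) (x : V B) : motive x :=
  Quotient.ind (fun p => h p.1 p.2.1 p.2.2) x

/-- Addition on `V(B)`: `[p] + [q] = [p ⊕ q]`. -/
instance : Add (V B) where
  add := Quotient.map₂
    (fun p q => ⟨p.1 + q.1, dsum p.2.1 q.2.1, isStarProjection_dsum p.2.2 q.2.2⟩)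
    (fun p p' h q q' h' => MvN.dsum p.2.2 q.2.2 p'.2.2 q'.2.2 h h')

instance : Zero (V B) where
  zero := V.mk (0 : Matrix (Fin 0) (Fin 0) B) (.zero _)

theorem V.mk_add_mk {m n : ℕ} {p : Matrix (Fin m) (Fin m) B} {q : Matrix (Fin n) (Fin n) B}
    (hp : IsStarProjection p) (hq : IsStarProjection q) :
    V.mk p hp + V.mk q hq = V.mk (dsum p q) (isStarProjection_dsum hp hq) := rfl

theorem V.zero_def : (0 : V B) = V.mk (0 : Matrix (Fin 0) (Fin 0) B) (.zero _) := rfl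

theorem V.mk_zero (n : ℕ) : V.mk (0 : Matrix (Fin n) (Fin n) B) (.zero _) = 0 :=
  V.mk_eq_mk.2 ⟨0, by simp, by simp⟩

/-- Projections that agree up to a relabelling of the index set have the same class. -/
theorem V.mk_eq_of_reindex {m n : ℕ} {ι : Type*} [Fintype ι] {p : Matrix (Fin m) (Fin m) B}
    {q : Matrix (Fin n) (Fin n) B} {hp : IsStarProjection p} {hq : IsStarProjection q}
    {r s : Matrix ι ι B} (h1 : MvN r p) (h2 : MvN s q) (h : r = s) :
    V.mk p hp = V.mk q hq := by
  subst h
  exact V.mk_eq_mk.2 (MvN.trans hp hq h1.symm h2)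

instance : AddCommMonoid (V B) where
  add_assoc x y z := by
    induction x using V.ind with | _ l p hp
    induction y using V.ind with | _ m q hq
    induction z using V.ind with | _ n r hr
    simp only [V.mk_add_mk]
    have hpq := isStarProjection_fromBlocks hp hq
    have hqr := isStarProjection_fromBlocks hq hr
    refine V.mk_eq_of_reindex (r := Matrix.reindex (Equiv.sumAssoc _ _ _) (Equiv.sumAssoc _ _ _)
        (Matrix.fromBlocks (Matrix.fromBlocks p 0 0 q) 0 0 r))
      (s := Matrix.fromBlocks p 0 0 (Matrix.fromBlocks q 0 0 r)) ?_ ?_ ?_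
    · refine MvN.trans (isStarProjection_reindex _ (isStarProjection_fromBlocks hpq hr))
        (isStarProjection_dsum (isStarProjection_dsum hp hq) hr)
        (mvN_reindex _ (isStarProjection_fromBlocks hpq hr)).symm ?_
      exact MvN.trans (isStarProjection_fromBlocks hpq hr)
        (isStarProjection_dsum (isStarProjection_dsum hp hq) hr)
        ((mvN_dsum hp hq).fromBlocks (MvN.refl hr)) (mvN_dsum (isStarProjection_dsum hp hq) hr)
    · exact MvN.trans (isStarProjection_fromBlocks hp hqr)
        (isStarProjection_dsum hp (isStarProjection_dsum hq hr))
        ((MvN.refl hp).fromBlocks (mvN_dsum hq hr)) (mvN_dsum hp (isStarProjection_dsum hq hr))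
    · ext (i | i | i) (j | j | j) <;> rfl
  zero_add x := by
    induction x using V.ind with | _ n p hp
    rw [V.zero_def, V.mk_add_mk]
    have h0 : IsStarProjection (0 : Matrix (Fin 0) (Fin 0) B) := .zero _
    refine V.mk_eq_of_reindex (r := Matrix.reindex (Equiv.emptySum (Fin 0) (Fin n))
      (Equiv.emptySum (Fin 0) (Fin n)) (Matrix.fromBlocks 0 0 0 p)) (s := p) ?_ ?_ ?_
    · exact MvN.trans (isStarProjection_reindex _ (isStarProjection_fromBlocks h0 hp))
        (isStarProjection_dsum h0 hp)
        (mvN_reindex _ (isStarProjection_fromBlocks h0 hp)).symm (mvN_dsum h0 hp)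
    · exact MvN.refl hp
    · ext i j; rfl
  add_zero x := by
    induction x using V.ind with | _ n p hp
    rw [V.zero_def, V.mk_add_mk]
    have h0 : IsStarProjection (0 : Matrix (Fin 0) (Fin 0) B) := .zero _
    refine V.mk_eq_of_reindex (r := Matrix.reindex (Equiv.sumEmpty (Fin n) (Fin 0))
      (Equiv.sumEmpty (Fin n) (Fin 0)) (Matrix.fromBlocks p 0 0 0)) (s := p) ?_ ?_ ?_
    · exact MvN.trans (isStarProjection_reindex _ (isStarProjection_fromBlocks hp h0))
        (isStarProjection_dsum hp h0)
        (mvN_reindex _ (isStarProjection_fromBlocks hp h0)).symm (mvN_dsum hp h0)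
    · exact MvN.refl hp
    · ext i j; rfl
  add_comm x y := by
    induction x using V.ind with | _ m p hp
    induction y using V.ind with | _ n q hq
    simp only [V.mk_add_mk]
    refine V.mk_eq_of_reindex (r := Matrix.reindex (Equiv.sumComm _ _) (Equiv.sumComm _ _)
      (Matrix.fromBlocks p 0 0 q)) (s := Matrix.fromBlocks q 0 0 p) ?_ ?_ ?_
    · exact MvN.trans (isStarProjection_reindex _ (isStarProjection_fromBlocks hp hq))
        (isStarProjection_dsum hp hq)
        (mvN_reindex _ (isStarProjection_fromBlocks hp hq)).symm (mvN_dsum hp hq)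
    · exact mvN_dsum hq hp
    · ext (i | i) (j | j) <;> rfl
  nsmul := nsmulRec

/-- The monoid homomorphism `V(B) → V(C)` induced by a `*`-homomorphism. -/
def V.map (φ : B →⋆ₙ+* C) : V B →+ V C where
  toFun := Quotient.map
    (fun p => ⟨p.1, p.2.1.map φ, isStarProjection_map φ p.2.2⟩) (fun _ _ h => h.map φ)
  map_zero' := V.mk_eq_mk.2 ⟨0, by ext i; exact i.elim0, by ext i; exact i.elim0⟩
  map_add' x y := by
    induction x using V.ind with | _ m p hp
    induction y using V.ind with | _ n q hq
    refine V.mk_eq_mk.2 ?_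
    change MvN ((dsum p q).map φ) (dsum (p.map φ) (q.map φ))
    rw [dsum_map]
    exact MvN.refl (isStarProjection_dsum (isStarProjection_map φ hp) (isStarProjection_map φ hq))

theorem V.map_mk (φ : B →⋆ₙ+* C) {n : ℕ} {p : Matrix (Fin n) (Fin n) B}
    (hp : IsStarProjection p) :
    V.map φ (V.mk p hp) = V.mk (p.map φ) (isStarProjection_map φ hp) := rfl

variable (B) in
/-- The Grothendieck group of `V(B)`; for unital `B` this is `K_0(B)`. -/
abbrev K00 : Type _ := Algebra.GrothendieckAddGroup (V B)

/-- The group homomorphism induced by a `*`-homomorphism on Grothendieck groups. -/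
def K00.map (φ : B →⋆ₙ+* C) : K00 B →+ K00 C :=
  Algebra.GrothendieckAddGroup.lift (Algebra.GrothendieckAddGroup.of.comp (V.map φ))

theorem K00.map_of (φ : B →⋆ₙ+* C) (x : V B) :
    K00.map φ (Algebra.GrothendieckAddGroup.of x) =
      Algebra.GrothendieckAddGroup.of (V.map φ x) := by
  have h := Algebra.GrothendieckAddGroup.lift.symm_apply_apply
    ((Algebra.GrothendieckAddGroup.of (M := V C)).comp (V.map φ))
  exact DFunLike.congr_fun h x

end Proj

/-! ### The `K_0`-group of a C*-algebra and its positive cone -/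

section K0

variable (A : Type*) [NonUnitalCStarAlgebra A]

/-- The canonical map from the (always enlarging) unitization of `A` to the scalars. -/
def scalarHom : Unitization ℂ A →⋆ₙ+* ℂ where
  toFun x := x.fst
  map_mul' x y := Unitization.fst_mul x y
  map_zero' := rfl
  map_add' _ _ := rfl
  map_star' _ := rfl

/-- The inclusion of `A` into its unitization. -/
def inclHom : A →⋆ₙ+* Unitization ℂ A where
  toFun a := (a : Unitization ℂ A)
  map_mul' a b := Unitization.inr_mul ℂ a b
  map_zero' := Unitization.inr_zero ℂ
  map_add' a b := Unitization.inr_add ℂ a b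
  map_star' a := Unitization.inr_star a

/-- `K_0(A)`, the kernel of the map `K_0(A⁺) → K_0(ℂ)` induced by the canonical map from the
unitization `A⁺ = A ⊕ ℂ` to `ℂ`. -/
def K0 : Type _ := (K00.map (scalarHom A)).ker

instance : AddCommGroup (K0 A) := inferInstanceAs (AddCommGroup (K00.map (scalarHom A)).ker)

variable {A}

/-- The class `[p]_0 ∈ K_0(A)` of a projection `p` in `M_n(A)`. -/
def K0.cls {n : ℕ} (p : Matrix (Fin n) (Fin n) A) (hp : IsStarProjection p) : K0 A :=
  ⟨Algebra.GrothendieckAddGroup.of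
    (V.mk (p.map (inclHom A)) (isStarProjection_map (inclHom A) hp)), by
    have h : (p.map (inclHom A)).map (scalarHom A) = 0 := by ext i j; rfl
    rw [AddMonoidHom.mem_ker, K00.map_of, V.map_mk]
    simp only [h, V.mk_zero, map_zero]⟩

theorem isStarProjection_single {p : A} (hp : IsStarProjection p) :
    IsStarProjection (Matrix.of fun _ _ : Fin 1 => p) := by
  obtain ⟨h1, h2⟩ := isStarProjection_iff'.1 hp
  refine isStarProjection_iff_conj.2 ⟨?_, ?_⟩
  · ext i j; simp [Matrix.mul_apply, h1]
  · ext i j; simp [h2]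

/-- The class `[p]_0 ∈ K_0(A)` of a projection `p` in `A`. -/
def K0.cls₁ (p : A) (hp : IsStarProjection p) : K0 A :=
  K0.cls (Matrix.of fun _ _ : Fin 1 => p) (isStarProjection_single hp)

theorem K0.cls_zero : K0.cls (0 : Matrix (Fin 0) (Fin 0) A) (.zero _) = 0 := by
  refine Subtype.ext ?_
  change Algebra.GrothendieckAddGroup.of (V.mk _ _) = 0
  have h : (0 : Matrix (Fin 0) (Fin 0) A).map (inclHom A) = 0 :=
    Subsingleton.elim _ _
  simp only [h, V.mk_zero, map_zero]

theorem K0.cls_add {m n : ℕ} {p : Matrix (Fin m) (Fin m) A} {q : Matrix (Fin n) (Fin n) A}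
    (hp : IsStarProjection p) (hq : IsStarProjection q) :
    K0.cls p hp + K0.cls q hq = K0.cls (dsum p q) (isStarProjection_dsum hp hq) := by
  refine Subtype.ext ?_
  change Algebra.GrothendieckAddGroup.of (V.mk _ _) + Algebra.GrothendieckAddGroup.of (V.mk _ _) =
    Algebra.GrothendieckAddGroup.of (V.mk _ _)
  rw [← map_add, V.mk_add_mk]
  simp only [dsum_map]

variable (A) in
/-- The positive cone `K_0(A)^+ = {[p]_0 : p ∈ P_∞(A)}`. -/
def K0.pos : AddSubmonoid (K0 A) where
  carrier := {g | ∃ (n : ℕ) (p : Matrix (Fin n) (Fin n) A) (hp : IsStarProjection p),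
    K0.cls p hp = g}
  zero_mem' := ⟨0, 0, .zero _, K0.cls_zero⟩
  add_mem' := by
    rintro _ _ ⟨m, p, hp, rfl⟩ ⟨n, q, hq, rfl⟩
    exact ⟨m + n, dsum p q, isStarProjection_dsum hp hq, (K0.cls_add hp hq).symm⟩

/-- The (pre)order of `K_0(A)`: `g ≤ h` means `h - g ∈ K_0(A)^+`. -/
instance : Preorder (K0 A) where
  le g h := h - g ∈ K0.pos A
  le_refl g := by rw [sub_self]; exact zero_mem _
  le_trans g h k h1 h2 := by
    have h3 := add_mem h2 h1
    rwa [sub_add_sub_cancel] at h3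

theorem K0.le_def {g h : K0 A} : g ≤ h ↔ h - g ∈ K0.pos A := Iff.rfl

variable (A) in
/-- `A` has cancellation: `[p]_0 = [q]_0` iff `p ∼ q`, for all projections `p`, `q` in matrix
algebras over `A`. -/
def HasCancellation : Prop :=
  ∀ (m n : ℕ) (p : Matrix (Fin m) (Fin m) A) (q : Matrix (Fin n) (Fin n) A)
    (hp : IsStarProjection p) (hq : IsStarProjection q),
    K0.cls p hp = K0.cls q hq ↔ MvN p q

variable (A) in
/-- The order of `K_0(A)` is a total order. -/
structure K0.IsTotallyOrdered : Prop where
  antisymm : ∀ g h : K0 A, g ≤ h → h ≤ g → g = h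
  total : ∀ g h : K0 A, g ≤ h ∨ h ≤ g

/-- Order ideals of `K_0(A)`: subgroups that are generated by their positive elements and
contain every positive element lying below one of their elements. -/
structure K0.IsOrderIdeal (J : AddSubgroup (K0 A)) : Prop where
  directed : ∀ g ∈ J, ∃ h ∈ J, ∃ k ∈ J, 0 ≤ h ∧ 0 ≤ k ∧ g = h - k
  hereditary : ∀ g h : K0 A, 0 ≤ g → g ≤ h → h ∈ J → g ∈ J

variable (A) in
/-- The ordered group `K_0(A)` is simple: it has no order ideals besides `0` and itself. -/
def K0.IsSimple : Prop := ∀ J : AddSubgroup (K0 A), K0.IsOrderIdeal J → J = ⊥ ∨ J = ⊤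

/-! ### Classes of C*-algebras -/

/-- `e` is the unit of `A`. -/
def IsIdentity (e : A) : Prop := ∀ a : A, e * a = a ∧ a * e = a

theorem IsIdentity.isStarProjection {e : A} (he : IsIdentity e) : IsStarProjection e := by
  refine isStarProjection_iff'.2 ⟨(he e).1, ?_⟩
  have h := congrArg star (he (star e)).2
  rw [star_mul, star_star, (he (star e)).2] at h
  exact h

variable (A) in
/-- `B` is the inductive limit of `A → M_2(A) → M_3(A) → ⋯` along the upper left corner
embeddings, in other words `B ≅ A ⊗ 𝒦`: there are compatible embeddings of the matrix algebras
`M_n(A)` into `B` whose ranges together are dense. -/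
def IsStabilization (B : Type*) [NonUnitalCStarAlgebra B] : Prop :=
  ∃ φ : ∀ n : ℕ, Matrix (Fin n) (Fin n) A →⋆ₙₐ[ℂ] B,
    (∀ n, Function.Injective (φ n)) ∧
    (∀ n x, φ (n + 1) (dsum x (0 : Matrix (Fin 1) (Fin 1) A)) = φ n x) ∧
    Dense (⋃ n, Set.range (φ n))

variable (A) in
/-- `A` is stable: `A ≅ A ⊗ 𝒦`. -/
def IsStable : Prop := IsStabilization A A

variable (A) in
/-- `A` has real rank zero: the invertible self-adjoint elements are dense among the self-adjoint
elements of the unitization of `A`. -/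
def RealRankZero : Prop :=
  ∀ x : Unitization ℂ A, IsSelfAdjoint x → ∀ ε : ℝ, 0 < ε →
    ∃ y : Unitization ℂ A, IsSelfAdjoint y ∧ IsUnit y ∧ ‖x - y‖ < ε

/-! ### Singular value functions -/

/-- The singular value function `s_g(a) = inf {‖a - a p‖ : p ∈ P(A), [p]_0 ≤ g}`. -/
def s (a : A) (g : K0.pos A) : ℝ≥0 :=
  sInf {r | ∃ (p : A) (hp : IsStarProjection p), K0.cls₁ p hp ≤ (g : K0 A) ∧ r = ‖a - a * p‖₊}

/-- The class of a projection of `A`, as an element of the positive cone. -/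
def K0.posCls₁ (p : A) (hp : IsStarProjection p) : K0.pos A :=
  ⟨K0.cls₁ p hp, 1, _, isStarProjection_single hp, rfl⟩

/-- A function on a preordered set vanishes at infinity. -/
def VanishesAtInfty {P : Type*} [Preorder P] (f : P → ℝ≥0) : Prop :=
  ∀ ε : ℝ≥0, 0 < ε → ∃ x, ∀ y, x ≤ y → f y < ε

end K0

/-! ### Functions on subsets of the half-line -/

section RealSets

variable {S : Set ℝ≥0}

/-- Right-continuity with respect to the relative topology. -/
def RightCts (f : S → ℝ≥0) : Prop := ∀ x : S, ContinuousWithinAt f (Set.Ici x) x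

/-- `f(x+) = sup {f(y) : y ∈ (x, ∞) ∩ S}`. -/
def rightVal (f : S → ℝ≥0) (x : ℝ≥0) : ℝ≥0 := sSup (f '' {y : S | x < y})

/-- `f(x-) = inf {f(y) : y ∈ [0, x) ∩ S}` for `x ≠ 0`, and `f(0-) = f(0)`
(for sets `S` that contain `0`). -/
def leftVal (f : S → ℝ≥0) (x : ℝ≥0) : ℝ≥0 :=
  sInf (f '' {y : S | (y : ℝ≥0) < x ∨ (y : ℝ≥0) = 0})

open Classical in
/-- The extension of `f` to the closure of `S`: at a point outside `S` it takes the value `f(x+)`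
if `x` is a right accumulation point of `S`, and the value `f(x-)` otherwise. -/
def ext (f : S → ℝ≥0) (x : closure S) : ℝ≥0 :=
  if hx : (x : ℝ≥0) ∈ S then f ⟨x, hx⟩
  else if (x : ℝ≥0) ∈ closure (S ∩ Set.Ioi (x : ℝ≥0)) then rightVal f x
  else leftVal f x

/-- The left-jump points `DP(h)` of a function on a set `T` (used for `T = closure S` and
`h = ext f`): the points `x ≠ 0` of `T` with `h(x-) > h(x)`. -/
def DP {T : Set ℝ≥0} (h : T → ℝ≥0) : Set ℝ≥0 :=
  {x | ∃ hx : x ∈ T, x ≠ 0 ∧ h ⟨x, hx⟩ < leftVal h x}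

end RealSets

/-! ### Realizing `K_0(A)^+` inside the half-line -/

section Embedding

variable {A : Type*} [NonUnitalCStarAlgebra A]

/-- An embedding of `(K_0(A), K_0(A)^+)` into `(ℝ, ℝ^+)` as an ordered group. -/
structure RealEmbedding (A : Type*) [NonUnitalCStarAlgebra A] where
  toHom : K0 A →+ ℝ
  injective : Function.Injective toHom
  nonneg_iff : ∀ g : K0 A, 0 ≤ toHom g ↔ g ∈ K0.pos A

/-- The inclusion of `K_0(A)^+` into `ℝ^+ = [0, ∞)` given by a real embedding. -/
def RealEmbedding.incl (j : RealEmbedding A) (g : K0.pos A) : ℝ≥0 :=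
  ⟨j.toHom g, (j.nonneg_iff g).2 g.2⟩

theorem RealEmbedding.incl_injective (j : RealEmbedding A) : Function.Injective j.incl :=
  fun _ _ h => Subtype.ext (j.injective (congrArg NNReal.toReal h))

/-- `K_0(A)^+` as a subset of `ℝ^+`. -/
def RealEmbedding.cone (j : RealEmbedding A) : Set ℝ≥0 := Set.range j.incl

/-- A function on `K_0(A)^+`, regarded as a function on a subset of `ℝ^+`. -/
def RealEmbedding.push (j : RealEmbedding A) (f : K0.pos A → ℝ≥0) : j.cone → ℝ≥0 :=
  fun x => f ((Equiv.ofInjective j.incl j.incl_injective).symm x)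

end Embedding

end SVF

end

noncomputable section

namespace SVF

/-! ### Comparison of projections in C*-algebras -/

section Comparison

/-! Embedding: the elements dominated by multiples of some `y > 0` form an order ideal, so
simplicity makes the totally ordered group Archimedean, and Hölder's theorem applies.

Both remaining assertions rest on a lower bound for singular values (`le_s_of_not_le`). If `c² e ≤ e
a*a e` and `‖a - a p‖ < c`, then `p` is bounded below on the range of `e` (`norm_sub_conj_lt_one`),
so `e` is equivalent to a subprojection of `p` and `[e] ≤ [p]`.

Regularity: real rank zero supplies approximate spectral projections `e` of `a*a`. For `0 < c < d`,
the function `s(a)` is at most `d` from `[e]` on and at least `c` at every class not above `[e]`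
(`RealRankZero.exists_crossing`). So `s(a)` can pass an interval of values only at a point of the
cone, which gives all three properties.

Realization: `a` should be positive, with spectral projections whose classes are the points where
`f` passes the corresponding values. Right-continuity and the condition on `DP` make the values
passed at a point of the cone dense (`exists_isLevel`). A finite chain of such levels `l k` with
decreasing projections `Q k` gives the element `∑ (l (k+1) - l k) Q k`, whose singular value
function is within the largest gap of `f`. Inserting a level in the middle third of each gap shrinks
the gaps by `2/3` and moves the element by at most the new gap bound. Cancellation places the new
projections between the old ones; the largest one comes from interpolation below the unit, or from
the room in a stable algebra. The limit realizes `f`, as `s_g` is Lipschitz in `a`. -/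

theorem exists_conj_eq_of_norm_lt_unital {B : Type*} [CStarAlgebra B] {q c : B}
    (hq : IsStarProjection q) (hc : IsSelfAdjoint c) (h : ‖q - q * c * q‖ < 1) :
    ∃ y : B, star (q * y) * c * (q * y) = q := by
  let _ := CStarAlgebra.spectralOrder B
  have _ := CStarAlgebra.spectralOrderedRing B
  have hqq : q * q = q := hq.isIdempotentElem
  have hqs : star q = q := hq.isSelfAdjoint
  -- Adding `1 - q` turns the compression, invertible in the corner of `q`, into an invertible
  -- element of `B` commuting with `q`; then so does `y = x^(-1/2)`, and `y (q c q) y = y x y q =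
  -- q`.
  set x : B := q * c * q + (1 - q) with hx
  have hz : IsSelfAdjoint (q - q * c * q) := by
    refine hq.isSelfAdjoint.sub ?_
    have := hc.conjugate_self hq.isSelfAdjoint
    exact this
  have hxz : x = 1 - (q - q * c * q) := by rw [hx]; abel
  have hxpos : IsStrictlyPositive x := by
    refine IsStrictlyPositive.of_le (a := algebraMap ℝ B (1 - ‖q - q * c * q‖)) ?_ ?_
    · exact (by
        rw [Algebra.algebraMap_eq_smul_one]
        exact isStrictlyPositive_one.smul (sub_pos.2 h))
    · rw [hxz, map_sub, map_one]
      exact sub_le_sub_left hz.le_algebraMap_norm_self 1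
  have hcomm : Commute x q := by
    rw [hx]
    refine Commute.add_left ?_ (Commute.sub_left (Commute.one_left q) (Commute.refl q))
    change q * c * q * q = q * (q * c * q)
    rw [mul_assoc _ q q, hqq, ← mul_assoc q (q * c), ← mul_assoc q q, hqq]
  set y : B := x ^ (-(1 / 2) : ℝ) with hy
  have hycomm : y * q = q * y := by
    have : Commute y q := by
      rw [hy, CFC.rpow_def]
      exact hcomm.cfc_nnreal _
    exact this
  have hys : star y = y := (CFC.rpow_nonneg (a := x)).isSelfAdjoint
  have hyxy : y * x * y = 1 := CFC.conjugate_rpow_neg_one_half x hxpos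
  have hqx : q * c * q = x * q := by
    rw [hx, add_mul, sub_mul, one_mul, hqq, sub_self, add_zero, mul_assoc _ q q, hqq]
  refine ⟨y, ?_⟩
  calc star (q * y) * c * (q * y) = y * (q * c * q) * y := by
        rw [star_mul, hys, hqs]; simp only [mul_assoc]
    _ = y * x * (q * y) := by rw [hqx]; simp only [mul_assoc]
    _ = q := by rw [← hycomm, ← mul_assoc, hyxy, one_mul]

/-- If the compression of `c` to the corner of the projection `q` is close to `q`, then `q` is of
the form `y* c y`. -/
theorem exists_conj_eq_of_norm_lt {D : Type*} [NonUnitalCStarAlgebra D] {q c : D}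
    (hq : IsStarProjection q) (hc : IsSelfAdjoint c) (h : ‖q - q * c * q‖ < 1) :
    ∃ y : D, star y * c * y = q := by
  obtain ⟨y, hy⟩ := exists_conj_eq_of_norm_lt_unital (B := Unitization ℂ D)
    (q := (q : Unitization ℂ D)) (c := (c : Unitization ℂ D)) hq.inr (hc.inr ℂ) (by
      rw [← Unitization.inr_mul, ← Unitization.inr_mul, ← Unitization.inr_sub,
        Unitization.norm_inr]
      exact h)
  -- The witness is `q y` rather than `y`: it lies in the ideal `D` of the unitization.
  have h0 : ((q : Unitization ℂ D) * y).fst = 0 := by simp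
  obtain ⟨z, hz⟩ : ∃ z : D, (z : Unitization ℂ D) = (q : Unitization ℂ D) * y := by
    lift ((q : Unitization ℂ D) * y) to D using h0 with z
    exact ⟨z, rfl⟩
  refine ⟨z, Unitization.inr_injective (R := ℂ) ?_⟩
  rw [Unitization.inr_mul, Unitization.inr_mul, Unitization.inr_star, hz, hy]

/-- If `a*a` is bounded below by `c ^ 2` on the range of the projection `e`, and has norm less
than `c` on the complement of the projection `p`, then `p` is bounded below on the range of `e`. -/
theorem norm_sub_conj_lt_one {D : Type*} [NonUnitalCStarAlgebra D] [PartialOrder D]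
    [StarOrderedRing D] {e p a : D} {c : ℝ} (he : IsStarProjection e) (hp : IsStarProjection p)
    (hc : 0 < c) (h1 : (c ^ 2) • e ≤ e * (star a * a) * e) (h2 : ‖a - a * p‖ < c) :
    ‖e - e * p * e‖ < 1 := by
  have hes : star e = e := he.isSelfAdjoint
  have hee : e * e = e := he.isIdempotentElem
  have hps : star p = p := hp.isSelfAdjoint
  have hpp : p * p = p := hp.isIdempotentElem
  set d : ℝ := ‖a - a * p‖ with hd
  have hd0 : 0 ≤ d := norm_nonneg _
  -- choose the weight in `(x + y)*(x + y) ≤ (1 + k) y*y + (1 + 1/k) x*x`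
  obtain ⟨k, hk0, hk⟩ : ∃ k : ℝ, 0 < k ∧ (1 + k) * d ^ 2 < c ^ 2 := by
    have hdc : d ^ 2 < c ^ 2 := by nlinarith
    -- With this `k`, `(1 + k) d² = 2 c² d² / (c² + d²)`, which is below `c²` because `d < c`.
    refine ⟨(c ^ 2 - d ^ 2) / (c ^ 2 + d ^ 2), by apply div_pos <;> nlinarith, ?_⟩
    have hpos : 0 < c ^ 2 + d ^ 2 := by positivity
    rw [one_add_div hpos.ne', div_mul_eq_mul_div, div_lt_iff₀ hpos]
    nlinarith [sq_nonneg d, sq_nonneg c]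
  set x : D := a * p * e with hx
  set y : D := (a - a * p) * e with hy
  have hxy : a * e = x + y := by rw [hx, hy, sub_mul]; abel
  have hae : star (a * e) * (a * e) = e * (star a * a) * e := by
    rw [star_mul, hes]; simp only [mul_assoc]
  have hxx : star x * x ≤ (‖a‖ ^ 2) • (e * p * e) := by
    have h := CStarAlgebra.star_left_conjugate_le_norm_smul (a := p * e) (b := star a * a)
      (IsSelfAdjoint.star_mul_self a)
    rw [CStarRing.norm_star_mul_self, ← pow_two] at h
    have e1 : star (p * e) * (star a * a) * (p * e) = star x * x := by
      rw [hx]; simp only [star_mul, mul_assoc]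
    have e2 : star (p * e) * (p * e) = e * p * e := by
      rw [star_mul, hes, hps, mul_assoc, ← mul_assoc p p, hpp, ← mul_assoc]
    rwa [e1, e2] at h
  have hyy : star y * y ≤ (d ^ 2) • e := by
    have h := CStarAlgebra.star_left_conjugate_le_norm_smul (a := e)
      (b := star (a - a * p) * (a - a * p)) (IsSelfAdjoint.star_mul_self _)
    rw [CStarRing.norm_star_mul_self, ← pow_two] at h
    have e1 : star e * (star (a - a * p) * (a - a * p)) * e = star y * y := by
      rw [hy]; simp only [star_mul, mul_assoc]
    rwa [e1, hes, hee] at h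
  -- Young's inequality, from expanding the square of `√k y - x / √k`.
  have hcross : star y * x + star x * y ≤ k • (star y * y) + k⁻¹ • (star x * x) := by
    have h := star_mul_self_nonneg (√k • y - (√k)⁻¹ • x)
    have hk2 : √k ≠ 0 := (Real.sqrt_pos.2 hk0).ne'
    have e1 : star (√k • y - (√k)⁻¹ • x) * (√k • y - (√k)⁻¹ • x) =
        k • (star y * y) + k⁻¹ • (star x * x) - (star y * x + star x * y) := by
      simp only [star_sub, star_smul, star_trivial, sub_mul, mul_sub, smul_mul_smul_comm,
        mul_inv_cancel₀ hk2, inv_mul_cancel₀ hk2, one_smul, ← mul_inv,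
        Real.mul_self_sqrt hk0.le]
      abel
    rw [e1] at h
    exact sub_nonneg.1 h
  set K : ℝ := (1 + k⁻¹) * ‖a‖ ^ 2 with hK
  set δ : ℝ := c ^ 2 - (1 + k) * d ^ 2 with hδ
  have hδ0 : 0 < δ := sub_pos.2 hk
  have hK0 : 0 ≤ K := by positivity
  have hepe0 : 0 ≤ e * p * e := by
    have := star_left_conjugate_nonneg hp.nonneg e
    rwa [hes] at this
  have hmain : δ • e ≤ K • (e * p * e) := by
    have h3 : (c ^ 2) • e ≤ ((1 + k) * d ^ 2) • e + K • (e * p * e) := by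
      calc (c ^ 2) • e ≤ e * (star a * a) * e := h1
        _ = star (x + y) * (x + y) := by rw [← hae, hxy]
        _ = star y * y + star x * x + (star y * x + star x * y) := by
            rw [star_add, add_mul, mul_add, mul_add]; abel
        _ ≤ star y * y + star x * x + (k • (star y * y) + k⁻¹ • (star x * x)) := by gcongr
        _ = (1 + k) • (star y * y) + (1 + k⁻¹) • (star x * x) := by
            rw [add_smul, add_smul, one_smul, one_smul]; abel
        _ ≤ (1 + k) • ((d ^ 2) • e) + (1 + k⁻¹) • ((‖a‖ ^ 2) • (e * p * e)) := by
            gcongr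
        _ = _ := by rw [smul_smul, smul_smul]
    rw [hδ, sub_smul, sub_le_iff_le_add']
    exact h3
  -- Replacing `K` by `K + δ` keeps the denominator positive and the quotient at most `1`.
  have hlow : (δ / (K + δ)) • e ≤ e * p * e := by
    have h3 : δ • e ≤ (K + δ) • (e * p * e) :=
      hmain.trans (by rw [add_smul]; exact le_add_of_nonneg_right (smul_nonneg hδ0.le hepe0))
    have h4 := smul_le_smul_of_nonneg_left h3 (show 0 ≤ (K + δ)⁻¹ by positivity)
    rwa [smul_smul, smul_smul, inv_mul_cancel₀ (by positivity), one_smul, mul_comm,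
      ← div_eq_mul_inv] at h4
  have hup : e * p * e ≤ e := by
    have h := CStarAlgebra.star_left_conjugate_le_norm_smul (a := e) (b := p) hp.isSelfAdjoint
    rw [hes, hee] at h
    refine h.trans ?_
    have := smul_le_smul_of_nonneg_right (IsStarProjection.norm_le p hp) he.nonneg
    rwa [one_smul] at this
  have hq : 0 < δ / (K + δ) := by positivity
  have hq1 : δ / (K + δ) ≤ 1 := (div_le_one (by positivity)).2 (by linarith)
  have hle : e - e * p * e ≤ (1 - δ / (K + δ)) • e := by
    rw [sub_smul, one_smul]; exact sub_le_sub_left hlow e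
  calc ‖e - e * p * e‖ ≤ ‖(1 - δ / (K + δ)) • e‖ :=
        CStarAlgebra.norm_le_norm_of_nonneg_of_le (sub_nonneg.2 hup) hle
    _ = (1 - δ / (K + δ)) * ‖e‖ := by
        rw [norm_smul, Real.norm_of_nonneg (by linarith)]
    _ ≤ (1 - δ / (K + δ)) * 1 := by
        exact mul_le_mul_of_nonneg_left (IsStarProjection.norm_le e he) (by linarith)
    _ < 1 := by linarith

/-- A projection `e` that is close to its compression by `p` is equivalent to a subprojection
of `p`. -/
theorem exists_partialIsometry_of_norm_lt {D : Type*} [NonUnitalCStarAlgebra D] {e p : D}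
    (he : IsStarProjection e) (hp : IsStarProjection p) (h : ‖e - e * p * e‖ < 1) :
    ∃ v : D, star v * v = e ∧ p * v = v := by
  obtain ⟨y, hy⟩ := exists_conj_eq_of_norm_lt he hp.isSelfAdjoint h
  refine ⟨p * y, ?_, ?_⟩
  · rw [star_mul, hp.isSelfAdjoint.star_eq, mul_assoc, ← mul_assoc p p,
      hp.isIdempotentElem.eq, ← mul_assoc, hy]
  · rw [← mul_assoc, hp.isIdempotentElem.eq]

theorem cfc_mul_self_mul_cfc {B : Type*} [CStarAlgebra B] {y : B} (hy : IsSelfAdjoint y)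
    {f : ℝ → ℝ} (hf : ContinuousOn f (spectrum ℝ y)) :
    cfc f y * y * cfc f y = cfc (fun r => f r * r * f r) y := by
  have h1 : cfc (fun r => f r * r) y = cfc f y * y := by
    conv_rhs => arg 2; rw [← cfc_id' ℝ y hy]
    exact cfc_mul f (fun r => r) y hf continuousOn_id
  rw [cfc_mul (fun r => f r * r) f y (hf.mul continuousOn_id) hf, h1]

/-- The spectral projection of an invertible self-adjoint element for the positive half-line. -/
theorem exists_positive_spectral_projection {B : Type*} [CStarAlgebra B] [PartialOrder B]
    [StarOrderedRing B] {y : B} (hys : IsSelfAdjoint y) (hyu : IsUnit y) :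
    ∃ e : B, IsStarProjection e ∧ 0 ≤ e * y * e ∧ (1 - e) * y * (1 - e) ≤ 0 := by
  have h0 : (0 : ℝ) ∉ spectrum ℝ y := spectrum.zero_notMem ℝ hyu
  set χ : ℝ → ℝ := fun r => if 0 < r then 1 else 0 with hχ
  -- The only discontinuity of `χ` is at `0`, which is not in the spectrum.
  have hχc : ContinuousOn χ (spectrum ℝ y) := by
    intro r hr
    have hr0 : r ≠ 0 := fun h => h0 (h ▸ hr)
    refine ContinuousAt.continuousWithinAt ?_
    rcases lt_or_gt_of_ne hr0 with h | h
    · refine (continuousAt_const (y := (0 : ℝ))).congr ?_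
      filter_upwards [Iio_mem_nhds h] with z hz
      exact (if_neg (not_lt.2 (Set.mem_Iio.1 hz).le)).symm
    · refine (continuousAt_const (y := (1 : ℝ))).congr ?_
      filter_upwards [Ioi_mem_nhds h] with z hz
      exact (if_pos (Set.mem_Ioi.1 hz)).symm
  refine ⟨cfc χ y, isStarProjection_iff'.2 ⟨?_, (cfc_predicate χ y : IsSelfAdjoint _)⟩, ?_, ?_⟩
  · rw [← cfc_mul χ χ y hχc hχc]
    congr 1
    funext r; simp only [hχ]; split_ifs <;> simp
  · rw [cfc_mul_self_mul_cfc hys hχc]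
    refine cfc_nonneg fun r _ => ?_
    simp only [hχ]; split_ifs with h
    · simpa using h.le
    · simp
  · have hc1 : ContinuousOn (fun r => 1 - χ r) (spectrum ℝ y) := continuousOn_const.sub hχc
    have h1 : 1 - cfc χ y = cfc (fun r => 1 - χ r) y := by
      rw [cfc_sub (fun _ => 1) χ y continuousOn_const hχc, cfc_const_one ℝ y]
    rw [h1, cfc_mul_self_mul_cfc hys hc1]
    refine cfc_nonpos _ _ fun r _ => ?_
    simp only [hχ]; split_ifs with h
    · simp
    · simpa using h

/-- In a C*-algebra of real rank zero there are projections that behave like spectral projections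
of `a*a`: they split `a*a` at the level `t` up to the error `η`. -/
theorem RealRankZero.exists_spectral_projection {A : Type*} [NonUnitalCStarAlgebra A]
    [PartialOrder A] [StarOrderedRing A] (hA : RealRankZero A) (a : A) {t η : ℝ}
    (hη : 0 < η) (ht : η < t) :
    ∃ e : A, IsStarProjection e ∧ ‖a - a * e‖ ^ 2 ≤ t + η ∧
      (t - η) • e ≤ e * (star a * a) * e := by
  set b : Unitization ℂ A := (a : Unitization ℂ A) with hb
  set x : Unitization ℂ A := star b * b - algebraMap ℝ _ t with hx
  have hxs : IsSelfAdjoint x :=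
    (IsSelfAdjoint.star_mul_self b).sub (IsSelfAdjoint.algebraMap _ (IsSelfAdjoint.all t))
  obtain ⟨y, hys, hyu, hxy⟩ := hA x hxs η hη
  obtain ⟨e, he, hpos, hneg⟩ := exists_positive_spectral_projection hys hyu
  have hes : star e = e := he.isSelfAdjoint
  have hee : e * e = e := he.isIdempotentElem
  -- the scalar part of `e` vanishes
  have hfst : e.fst = 0 := by
    have h1 : e.fst * e.fst = e.fst := by
      rw [← Unitization.fst_mul, hee]
    -- The scalar part is `0` or `1`. If it were `1`, positivity of `e y e` would give `y` a scalar
    -- part with nonnegative real part, while that of `x` is `-t`; then `‖x - y‖ ≥ t > η`.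
    by_contra hne
    have h2 : e.fst = 1 := mul_left_cancel₀ hne (by rw [h1, mul_one])
    obtain ⟨z, hz⟩ := CStarAlgebra.nonneg_iff_eq_star_mul_self.1 hpos
    have h3 : y.fst = star z.fst * z.fst := by
      have := congrArg (fun w : Unitization ℂ A => w.fst) hz
      simpa [h2] using this
    have h4 : 0 ≤ y.fst.re := by
      rw [h3]
      simp only [Complex.star_def, ← Complex.normSq_eq_conj_mul_self, Complex.ofReal_re]
      exact Complex.normSq_nonneg _
    have h5 : (x - y).fst.re = - t - y.fst.re := by
      have e1 : x + t • 1 = star b * b := by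
        rw [hx, Algebra.algebraMap_eq_smul_one]; abel
      have e2 := congrArg (fun w : Unitization ℂ A => w.fst.re) e1
      simp [hb] at e2
      change x.fst.re - y.fst.re = _
      linarith
    have h6 : ‖(x - y).fst‖ ≤ ‖x - y‖ := by
      rw [Unitization.norm_eq_sup]
      exact le_max_left _ _
    have h7 := (Complex.abs_re_le_norm (x - y).fst).trans h6
    rw [h5] at h7
    have h8 := neg_abs_le (-t - y.fst.re)
    linarith
  have hxy1 : x - y ≤ algebraMap ℝ _ η := by
    refine (IsSelfAdjoint.le_algebraMap_norm_self (hxs.sub hys)).trans ?_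
    exact algebraMap_mono _ hxy.le
  have hxy2 : -(algebraMap ℝ _ η) ≤ x - y := by
    refine le_trans ?_ (IsSelfAdjoint.neg_algebraMap_norm_le_self (hxs.sub hys))
    exact neg_le_neg (algebraMap_mono _ hxy.le)
  have hfs : star (1 - e) = 1 - e := by rw [star_sub, star_one, hes]
  have hff : (1 - e) * (1 - e) = 1 - e := he.one_sub.isIdempotentElem
  -- Write `star b * b = (x - y) + y + t`: on the range of `1 - e` the middle term is negative and
  -- the first is at most `η`. The lower bound on the range of `e` is symmetric.
  have hup : (1 - e) * (star b * b) * (1 - e) ≤ (t + η) • (1 - e) := by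
    have h1 := star_left_conjugate_le_conjugate hxy1 (1 - e)
    rw [hfs] at h1
    have h2 : (1 - e) * (star b * b) * (1 - e) = (1 - e) * (x - y) * (1 - e) +
        (1 - e) * y * (1 - e) + t • (1 - e) := by
      have : star b * b = (x - y) + y + t • 1 := by
        rw [hx, Algebra.algebraMap_eq_smul_one]; abel
      rw [this]
      simp only [mul_add, add_mul, mul_smul_comm, smul_mul_assoc, mul_one, hff]
    have h3 : (1 - e) * algebraMap ℝ _ η * (1 - e) = η • (1 - e) := by
      rw [Algebra.algebraMap_eq_smul_one, mul_smul_comm, mul_one, smul_mul_assoc, hff]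
    rw [h2, add_smul, add_comm]
    rw [h3] at h1
    gcongr
    calc _ ≤ η • (1 - e) + 0 := add_le_add h1 hneg
      _ = _ := add_zero _
  have hlow : (t - η) • e ≤ e * (star b * b) * e := by
    have h1 := star_left_conjugate_le_conjugate hxy2 e
    rw [hes] at h1
    have h2 : e * (star b * b) * e = e * (x - y) * e + e * y * e + t • e := by
      have : star b * b = (x - y) + y + t • 1 := by
        rw [hx, Algebra.algebraMap_eq_smul_one]; abel
      rw [this]
      simp only [mul_add, add_mul, mul_smul_comm, smul_mul_assoc, mul_one, hee]
    have h3 : e * -(algebraMap ℝ _ η) * e = -(η • e) := by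
      rw [Algebra.algebraMap_eq_smul_one, mul_neg, neg_mul, mul_smul_comm, mul_one,
        smul_mul_assoc, hee]
    rw [h2, sub_smul, sub_eq_neg_add]
    rw [h3] at h1
    gcongr
    calc _ = -(η • e) + 0 := (add_zero _).symm
      _ ≤ _ := add_le_add h1 hpos
  have hnorm : ‖b - b * e‖ ^ 2 ≤ t + η := by
    have h1 : star (b - b * e) * (b - b * e) = (1 - e) * (star b * b) * (1 - e) := by
      have : b - b * e = b * (1 - e) := by rw [mul_sub, mul_one]
      rw [this, star_mul, hfs]; simp only [mul_assoc]
    rw [pow_two, ← CStarRing.norm_star_mul_self, h1]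
    have h0 : 0 ≤ (1 - e) * (star b * b) * (1 - e) := by
      rw [← h1]; exact star_mul_self_nonneg _
    refine (CStarAlgebra.norm_le_norm_of_nonneg_of_le h0 hup).trans ?_
    rw [norm_smul, Real.norm_of_nonneg (by linarith)]
    exact mul_le_of_le_one_right (by linarith) (IsStarProjection.norm_le _ he.one_sub)
  lift e to A using hfst with e₀
  have hs : star e₀ = e₀ := Unitization.inr_injective (R := ℂ) (by rw [Unitization.inr_star, hes])
  refine ⟨e₀, isStarProjection_iff'.2 ⟨?_, hs⟩, ?_, ?_⟩
  · exact Unitization.inr_injective (R := ℂ) (by rw [Unitization.inr_mul, hee])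
  · rwa [hb, ← Unitization.inr_mul, ← Unitization.inr_sub, Unitization.norm_inr] at hnorm
  · rw [← Unitization.inr_le_iff _ _ ((IsSelfAdjoint.all _).smul hs) ?_]
    · simpa only [Unitization.inr_smul, Unitization.inr_mul, Unitization.inr_star] using hlow
    · have := (IsSelfAdjoint.star_mul_self a).conjugate e₀
      rwa [hs] at this

end Comparison

/-! ### Projections and their classes in `K_0` -/

section Classes

variable {A : Type*} [NonUnitalCStarAlgebra A]

theorem isStarProjection_mul_eq_symm {R : Type*} [Mul R] [StarMul R] {p q : R}
    (hp : IsStarProjection p) (hq : IsStarProjection q) (h : p * q = p) : q * p = p := by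
  have := congrArg star h
  rwa [star_mul, hp.isSelfAdjoint.star_eq, hq.isSelfAdjoint.star_eq] at this

theorem isStarProjection_mul_eq_zero_symm {R : Type*} [NonUnitalRing R] [StarRing R] {p q : R}
    (hp : IsStarProjection p) (hq : IsStarProjection q) (h : p * q = 0) : q * p = 0 := by
  have := congrArg star h
  rwa [star_mul, hp.isSelfAdjoint.star_eq, hq.isSelfAdjoint.star_eq, star_zero] at this

theorem isStarProjection_add_of_mul_eq_zero {R : Type*} [NonUnitalRing R] [StarRing R] {p q : R}
    (hp : IsStarProjection p) (hq : IsStarProjection q) (h : p * q = 0) :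
    IsStarProjection (p + q) := by
  refine isStarProjection_iff'.2 ⟨?_, ?_⟩
  · rw [add_mul, mul_add, mul_add, h, isStarProjection_mul_eq_zero_symm hp hq h,
      hp.isIdempotentElem.eq, hq.isIdempotentElem.eq, add_zero, zero_add]
  · rw [star_add, hp.isSelfAdjoint.star_eq, hq.isSelfAdjoint.star_eq]

theorem isStarProjection_sub_of_mul_eq {R : Type*} [NonUnitalRing R] [StarRing R] {p q : R}
    (hp : IsStarProjection p) (hq : IsStarProjection q) (h : p * q = p) :
    IsStarProjection (q - p) := by
  refine isStarProjection_iff'.2 ⟨?_, ?_⟩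
  · rw [sub_mul, mul_sub, mul_sub, h, isStarProjection_mul_eq_symm hp hq h,
      hp.isIdempotentElem.eq, hq.isIdempotentElem.eq, sub_self, sub_zero]
  · rw [star_sub, hp.isSelfAdjoint.star_eq, hq.isSelfAdjoint.star_eq]

theorem mul_star_self_isStarProjection {R : Type*} [NonUnitalRing R] [StarRing R] {v e : R}
    (h : star v * v = e) (hve : v * e = v) : IsStarProjection (v * star v) := by
  refine isStarProjection_iff'.2 ⟨?_, ?_⟩
  · rw [mul_assoc, ← mul_assoc (star v), h, ← mul_assoc, hve]
  · rw [star_mul, star_star]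

/-- A partial isometry is fixed by its source projection. -/
theorem mul_eq_of_star_mul_self {v e : A} (he : IsStarProjection e) (h : star v * v = e) :
    v * e = v := by
  have h0 : star (v * e - v) * (v * e - v) = 0 := by
    rw [star_sub, star_mul, he.isSelfAdjoint.star_eq, sub_mul, mul_sub, mul_sub,
      mul_assoc e, ← mul_assoc (star v) v e, h, he.isIdempotentElem.eq, mul_assoc e, h,
      he.isIdempotentElem.eq, sub_self]
  exact sub_eq_zero.1 (CStarRing.star_mul_self_eq_zero_iff _ |>.1 h0)

theorem K0.cls_eq_of_mvN {m n : ℕ} {p : Matrix (Fin m) (Fin m) A} {q : Matrix (Fin n) (Fin n) A}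
    (hp : IsStarProjection p) (hq : IsStarProjection q) (h : MvN p q) :
    K0.cls p hp = K0.cls q hq := by
  refine Subtype.ext ?_
  change Algebra.GrothendieckAddGroup.of (V.mk _ _) = Algebra.GrothendieckAddGroup.of (V.mk _ _)
  rw [V.mk_eq_mk.2 (h.map (inclHom A))]

theorem K0.cls_zero' (n : ℕ) (h : IsStarProjection (0 : Matrix (Fin n) (Fin n) A)) :
    K0.cls (0 : Matrix (Fin n) (Fin n) A) h = 0 := by
  rw [← K0.cls_zero]
  exact K0.cls_eq_of_mvN _ _ ⟨0, by simp, by simp⟩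

theorem K0.cls₁_zero (h : IsStarProjection (0 : A)) : K0.cls₁ (0 : A) h = 0 := by
  refine (K0.cls_eq_of_mvN _ (.zero _) ?_).trans (K0.cls_zero' 1 (.zero _))
  exact ⟨0, by ext i j; simp, by simp⟩

theorem K0.cls₁_eq_of_partialIsometry {v p q : A} (hp : IsStarProjection p)
    (hq : IsStarProjection q) (h1 : star v * v = p) (h2 : v * star v = q) :
    K0.cls₁ p hp = K0.cls₁ q hq := by
  refine K0.cls_eq_of_mvN _ _ ⟨Matrix.of fun _ _ : Fin 1 => v, ?_, ?_⟩
  · ext i j; simp [Matrix.mul_apply, h1]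
  · ext i j; simp [Matrix.mul_apply, h2]

theorem K0.cls₁_add {p q : A} (hp : IsStarProjection p) (hq : IsStarProjection q)
    (h : p * q = 0) (hpq : IsStarProjection (p + q)) :
    K0.cls₁ p hp + K0.cls₁ q hq = K0.cls₁ (p + q) hpq := by
  have h' := isStarProjection_mul_eq_zero_symm hp hq h
  have hp1 := isStarProjection_single hp
  have hq1 := isStarProjection_single hq
  rw [K0.cls₁, K0.cls₁, K0.cls_add]
  refine K0.cls_eq_of_mvN _ _ (MvN.trans (isStarProjection_dsum hp1 hq1)
    (isStarProjection_single hpq) (mvN_dsum hp1 hq1).symm ?_)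
  -- For the row `v = (p, q)`, `v*v = diag(p, q)` by orthogonality, and `v v* = p + q`.
  refine ⟨Matrix.fromCols (Matrix.of fun _ _ : Fin 1 => p) (Matrix.of fun _ _ : Fin 1 => q), ?_, ?_⟩
  · ext (i | i) (j | j) <;>
      simp [Matrix.mul_apply, hp.isSelfAdjoint.star_eq, hq.isSelfAdjoint.star_eq, h, h',
        hp.isIdempotentElem.eq, hq.isIdempotentElem.eq]
  · ext i j
    simp [Matrix.mul_apply, hp.isSelfAdjoint.star_eq, hq.isSelfAdjoint.star_eq,
      hp.isIdempotentElem.eq, hq.isIdempotentElem.eq]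

theorem K0.cls₁_mem_pos {p : A} (hp : IsStarProjection p) : K0.cls₁ p hp ∈ K0.pos A :=
  ⟨1, _, _, rfl⟩

theorem K0.cls₁_sub {p q : A} (hp : IsStarProjection p) (hq : IsStarProjection q)
    (h : p * q = p) (hpq : IsStarProjection (q - p)) :
    K0.cls₁ (q - p) hpq = K0.cls₁ q hq - K0.cls₁ p hp := by
  have h1 : p * (q - p) = 0 := by rw [mul_sub, h, hp.isIdempotentElem.eq, sub_self]
  have h2 : p + (q - p) = q := by abel
  rw [eq_sub_iff_add_eq', K0.cls₁_add hp hpq h1 (by rwa [h2])]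
  congr 1

theorem K0.cls₁_le_of_mul_eq {p q : A} (hp : IsStarProjection p) (hq : IsStarProjection q)
    (h : p * q = p) : K0.cls₁ p hp ≤ K0.cls₁ q hq := by
  rw [K0.le_def, ← K0.cls₁_sub hp hq h (isStarProjection_sub_of_mul_eq hp hq h)]
  exact K0.cls₁_mem_pos _

/-- A projection that is equivalent to a subprojection of `p` has a smaller class than `p`. -/
theorem K0.cls₁_le_of_partialIsometry {v e p : A} (he : IsStarProjection e)
    (hp : IsStarProjection p) (h1 : star v * v = e) (h2 : p * v = v) :
    K0.cls₁ e he ≤ K0.cls₁ p hp := by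
  have hr := mul_star_self_isStarProjection h1 (mul_eq_of_star_mul_self he h1)
  rw [K0.cls₁_eq_of_partialIsometry he hr h1 rfl]
  refine K0.cls₁_le_of_mul_eq hr hp ?_
  have h3 : p * (v * star v) = v * star v := by rw [← mul_assoc, h2]
  have := congrArg star h3
  rwa [star_mul, hr.isSelfAdjoint.star_eq, hp.isSelfAdjoint.star_eq] at this

theorem K0.cls₁_le_of_norm_lt {e p : A} (he : IsStarProjection e) (hp : IsStarProjection p)
    (h : ‖e - e * p * e‖ < 1) : K0.cls₁ e he ≤ K0.cls₁ p hp := by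
  obtain ⟨v, h1, h2⟩ := exists_partialIsometry_of_norm_lt he hp h
  exact K0.cls₁_le_of_partialIsometry he hp h1 h2

/-- The range projection of a row that is a partial isometry. -/
theorem exists_projection_of_row {n : ℕ} {q : Matrix (Fin n) (Fin n) A} (hq : IsStarProjection q)
    {w : Matrix (Fin 1) (Fin n) A} (hw : wᴴ * w = q) (hwq : w * q = w) :
    ∃ (r : A) (hr : IsStarProjection r), (w * wᴴ = Matrix.of fun _ _ : Fin 1 => r) ∧
      K0.cls₁ r hr = K0.cls q hq := by
  set r : A := (w * wᴴ) 0 0 with hrdef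
  have hwr : w * wᴴ = Matrix.of fun _ _ : Fin 1 => r := by
    ext i j; rw [Subsingleton.elim i 0, Subsingleton.elim j 0]; rfl
  have hrs : star r = r := by
    have : (w * wᴴ)ᴴ = w * wᴴ := by
      rw [Matrix.conjTranspose_mul, Matrix.conjTranspose_conjTranspose]
    exact congrFun (congrFun this 0) 0
  have hrr : r * r = r := by
    have : (w * wᴴ) * (w * wᴴ) = w * wᴴ := by
      rw [Matrix.mul_assoc, ← Matrix.mul_assoc wᴴ, hw, ← Matrix.mul_assoc, hwq]
    rw [hwr] at this
    simpa [Matrix.mul_apply] using congrFun (congrFun this 0) 0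
  exact ⟨r, isStarProjection_iff'.2 ⟨hrr, hrs⟩, hwr, (K0.cls_eq_of_mvN _ _ ⟨w, hw, hwr⟩).symm⟩

/-- In the presence of cancellation, every intermediate class is realized by an intermediate
projection. -/
theorem HasCancellation.exists_between (hA : HasCancellation A) {p r : A}
    (hp : IsStarProjection p) (hr : IsStarProjection r) (hpr : p * r = p) {x : K0 A}
    (h1 : K0.cls₁ p hp ≤ x) (h2 : x ≤ K0.cls₁ r hr) :
    ∃ (q : A) (hq : IsStarProjection q), p * q = p ∧ q * r = q ∧ K0.cls₁ q hq = x := by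
  obtain ⟨n, q₁, hq₁, e1⟩ := K0.le_def.1 h1
  obtain ⟨m, q₂, hq₂, e2⟩ := K0.le_def.1 h2
  have hrp := isStarProjection_sub_of_mul_eq hp hr hpr
  have hd := isStarProjection_dsum hq₁ hq₂
  -- The differences `x - [p]` and `[r] - x` are the classes of `q₁` and `q₂`, so cancellation makes
  -- `q₁ ⊕ q₂` equivalent to `r - p`. This equivalence carries `q₁ ⊕ 0` to a subprojection `t` of `r
  -- - p`, and `p + t` has class `x`.
  have e3 : K0.cls (dsum q₁ q₂) hd = K0.cls₁ (r - p) hrp := by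
    rw [← K0.cls_add hq₁ hq₂, e1, e2, K0.cls₁_sub hp hr hpr]; abel
  obtain ⟨v, hv1, hv2⟩ := (hA _ _ _ _ _ _).1 e3
  have hD := isStarProjection_dsum hq₁ (IsStarProjection.zero (Matrix (Fin m) (Fin m) A))
  set D := dsum q₁ (0 : Matrix (Fin m) (Fin m) A) with hDdef
  have hDD : D * D = D := hD.isIdempotentElem
  have hDs : Dᴴ = D := hD.isSelfAdjoint
  have hdD : dsum q₁ q₂ * D = D := by
    have hq₁' : q₁ * q₁ = q₁ := hq₁.isIdempotentElem
    rw [hDdef, dsum, dsum, Matrix.reindex_apply, Matrix.reindex_apply,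
      Matrix.submatrix_mul_equiv, Matrix.fromBlocks_multiply]
    simp [hq₁']
  set w := v * D with hw
  have hww : wᴴ * w = D := by
    rw [hw, Matrix.conjTranspose_mul, hDs, Matrix.mul_assoc, ← Matrix.mul_assoc vᴴ, hv1, hdD, hDD]
  have hwD : w * D = w := by rw [hw, Matrix.mul_assoc, hDD]
  have hvw : (Matrix.of fun _ _ : Fin 1 => r - p) * w = w := by
    rw [← hv2, hw, Matrix.mul_assoc, ← Matrix.mul_assoc vᴴ, hv1, hdD]
  obtain ⟨t, htp, hwt, htc⟩ := exists_projection_of_row hD hww hwD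
  have hts : star t = t := htp.isSelfAdjoint
  have hrt : (r - p) * t = t := by
    have : (Matrix.of fun _ _ : Fin 1 => r - p) * (w * wᴴ) = w * wᴴ := by
      rw [← Matrix.mul_assoc, hvw]
    rw [hwt] at this
    have := congrFun (congrFun this 0) 0
    simpa [Matrix.mul_apply] using this
  have hpt : p * t = 0 := by
    rw [← hrt, ← mul_assoc, mul_sub, hpr, hp.isIdempotentElem.eq, sub_self, zero_mul]
  have htr : t * r = t := by
    have : r * t = t := by
      nth_rewrite 1 [← hrt]
      rw [← mul_assoc, mul_sub, hr.isIdempotentElem.eq, isStarProjection_mul_eq_symm hp hr hpr, hrt]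
    have := congrArg star this
    rwa [star_mul, hts, hr.isSelfAdjoint.star_eq] at this
  have hq := isStarProjection_add_of_mul_eq_zero hp htp hpt
  refine ⟨p + t, hq, ?_, ?_, ?_⟩
  · rw [mul_add, hpt, hp.isIdempotentElem.eq, add_zero]
  · rw [add_mul, hpr, htr]
  · rw [← K0.cls₁_add hp htp hpt, htc, ← K0.cls_add hq₁ (.zero _), K0.cls_zero', e1]
    abel

end Classes

/-! ### The embedding into the reals -/

section Order

variable {A : Type*} [NonUnitalCStarAlgebra A]

theorem RealEmbedding.le_iff (j : RealEmbedding A) {g h : K0 A} :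
    j.toHom g ≤ j.toHom h ↔ g ≤ h := by
  rw [K0.le_def, ← j.nonneg_iff, map_sub, sub_nonneg]

theorem RealEmbedding.incl_le_iff (j : RealEmbedding A) {g h : K0.pos A} :
    j.incl g ≤ j.incl h ↔ g ≤ h := j.le_iff

theorem RealEmbedding.incl_lt_iff (j : RealEmbedding A) {g h : K0.pos A} :
    j.incl g < j.incl h ↔ ¬ h ≤ g := by
  rw [← not_le, j.incl_le_iff]

/-- A simple totally ordered `K_0`-group embeds into the reals. -/
theorem K0.nonempty_realEmbedding (hs : K0.IsSimple A) (ht : K0.IsTotallyOrdered A) :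
    Nonempty (RealEmbedding A) := by
  classical
  let _ : LinearOrder (K0 A) :=
    { (inferInstance : Preorder (K0 A)) with
      le_antisymm := ht.antisymm
      le_total := ht.total
      toDecidableLE := Classical.decRel _ }
  have _ : IsOrderedAddMonoid (K0 A) :=
    { add_le_add_left := fun a b h c => by
        rw [K0.le_def] at h ⊢
        rwa [add_sub_add_right_eq_sub] }
  have _ : Archimedean (K0 A) := by
    refine ⟨fun x y hy => ?_⟩
    -- The order ideal generated by `y`; it is nonzero, hence everything by simplicity.
    let J : AddSubgroup (K0 A) :=
      { carrier := {g | ∃ n : ℕ, |g| ≤ n • y}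
        zero_mem' := ⟨0, by simp⟩
        add_mem' := by
          rintro a b ⟨n, hn⟩ ⟨m, hm⟩
          exact ⟨n + m, (abs_add_le a b).trans (by rw [add_smul]; exact add_le_add hn hm)⟩
        neg_mem' := by
          rintro a ⟨n, hn⟩
          exact ⟨n, by rwa [abs_neg]⟩ }
    have hyJ : y ∈ J := ⟨1, by rw [one_smul, abs_of_pos hy]⟩
    have hJ : K0.IsOrderIdeal J := by
      refine ⟨fun g hg => ?_, fun g h hg hgh => ?_⟩
      · rcases ht.total 0 g with h | h
        · exact ⟨g, hg, 0, J.zero_mem, h, le_rfl, (sub_zero g).symm⟩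
        · exact ⟨0, J.zero_mem, -g, J.neg_mem hg, le_rfl, neg_nonneg.2 h, by abel⟩
      · rintro ⟨n, hn⟩
        exact ⟨n, by rw [abs_of_nonneg hg]; exact hgh.trans ((le_abs_self h).trans hn)⟩
    rcases hs J hJ with h | h
    · exact absurd (by rw [h] at hyJ; exact hyJ) hy.ne'
    · have : x ∈ J := by rw [h]; trivial
      obtain ⟨n, hn⟩ := this
      exact ⟨n, (le_abs_self x).trans hn⟩
  obtain ⟨f, hfi⟩ := Archimedean.exists_orderAddMonoidHom_real_injective (K0 A)
  have hf : StrictMono f := f.monotone'.strictMono_of_injective hfi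
  refine ⟨⟨f, hfi, fun g => ?_⟩⟩
  change 0 ≤ f g ↔ _
  rw [← map_zero f, hf.le_iff_le, K0.le_def, sub_zero]

end Order

/-! ### Stable algebras -/

section Stable

open Filter Topology

section

variable {B : Type*} [NonUnitalRing B] {m n : ℕ}

theorem dsum_apply_castAdd (p : Matrix (Fin m) (Fin m) B) (q : Matrix (Fin n) (Fin n) B)
    (i j : Fin m) : dsum p q (Fin.castAdd n i) (Fin.castAdd n j) = p i j := by
  simp [dsum]

/-- This lets the one-step compatibility of the corner embeddings be iterated. The index types agree
because `n + k + 1` and `n + (k + 1)` are definitionally equal. -/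
theorem dsum_zero_assoc (k : ℕ) (x : Matrix (Fin n) (Fin n) B) :
    dsum (dsum x (0 : Matrix (Fin k) (Fin k) B)) (0 : Matrix (Fin 1) (Fin 1) B) =
      dsum x (0 : Matrix (Fin (k + 1)) (Fin (k + 1)) B) := by
  have h1 : ∀ i : Fin n, Fin.castAdd 1 (Fin.castAdd k i) = Fin.castAdd (k + 1) i := fun _ => rfl
  have h2 : ∀ i : Fin k, Fin.castAdd 1 (Fin.natAdd n i) = Fin.natAdd n (Fin.castAdd 1 i) :=
    fun _ => rfl
  have h3 : ∀ i : Fin 1, Fin.natAdd (n + k) i = Fin.natAdd n (Fin.natAdd k i) :=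
    fun i => Fin.ext (by simp)
  have hl : ∀ {l : ℕ} (p : Matrix (Fin n) (Fin n) B) (i : Fin l) (j : Fin (n + l)),
      dsum p (0 : Matrix (Fin l) (Fin l) B) (Fin.natAdd n i) j = 0 := by
    intro l p i j
    refine Fin.addCases (fun j => ?_) (fun j => ?_) j <;> simp [dsum]
  have hr : ∀ {l : ℕ} (p : Matrix (Fin n) (Fin n) B) (i : Fin (n + l)) (j : Fin l),
      dsum p (0 : Matrix (Fin l) (Fin l) B) i (Fin.natAdd n j) = 0 := by
    intro l p i j
    refine Fin.addCases (fun i => ?_) (fun i => ?_) i <;> simp [dsum]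
  ext i j
  refine Fin.addCases (fun i => ?_) (fun i => ?_) i
  · refine Fin.addCases (fun j => ?_) (fun j => ?_) j
    · rw [dsum_apply_castAdd]
      refine Fin.addCases (fun i => ?_) (fun i => ?_) i
      · refine Fin.addCases (fun j => ?_) (fun j => ?_) j
        · rw [dsum_apply_castAdd, h1, h1, dsum_apply_castAdd]
        · rw [hr, h2, hr]
      · rw [hl, h2, hl]
    · trans 0
      · simp [dsum]
      · rw [h3]; exact (hr _ _ _).symm
  · trans 0
    · refine Fin.addCases (fun j => ?_) (fun j => ?_) j <;> simp [dsum]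
    · rw [h3]; exact (hl _ _ _).symm

end

variable {A : Type*} [NonUnitalCStarAlgebra A]

/-- The topology of `CStarMatrix` is by construction that of entrywise convergence. -/
theorem tendsto_cstarMatrix_iff [PartialOrder A] [StarOrderedRing A] {m : ℕ}
    {C : ℕ → Matrix (Fin m) (Fin m) A} {q : Matrix (Fin m) (Fin m) A}
    (h : ∀ j k, Tendsto (fun N => C N j k) atTop (𝓝 (q j k))) :
    Tendsto (fun N => CStarMatrix.ofMatrix (C N)) atTop (𝓝 (CStarMatrix.ofMatrix q)) := by
  have : Tendsto C atTop (𝓝 q) := tendsto_pi_nhds.2 fun j => tendsto_pi_nhds.2 fun k => h j k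
  exact this

/-- If a projection over `A` can be approximated by matrices `W* W` with rows `W` in the right
ideal annihilated by the projection `p`, then it is equivalent to a projection of `A` that is
orthogonal to `p`. -/
theorem exists_orthogonal_of_tendsto {m : ℕ} {q : Matrix (Fin m) (Fin m) A}
    (hq : IsStarProjection q) {p : A} {W : ℕ → Fin m → A}
    (hpW : ∀ N j, p * W N j = 0)
    (hW : ∀ j k, Tendsto (fun N => star (W N j) * W N k) atTop (𝓝 (q j k))) :
    ∃ (r : A) (hr : IsStarProjection r), p * r = 0 ∧
      K0.cls₁ r hr = K0.cls q hq := by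
  let _ := CStarAlgebra.spectralOrder A
  have _ := CStarAlgebra.spectralOrderedRing A
  set Q : CStarMatrix (Fin m) (Fin m) A := CStarMatrix.ofMatrix q with hQdef
  have hQ : IsStarProjection Q := ⟨hq.isIdempotentElem, hq.isSelfAdjoint⟩
  set R : ℕ → Matrix (Fin 1) (Fin m) A := fun N => Matrix.of fun _ j => W N j with hR
  have hlim := tendsto_cstarMatrix_iff (C := fun N => (R N)ᴴ * R N) (q := q)
    (by intro j k; simpa [hR, Matrix.mul_apply] using hW j k)
  have hlim2 : Tendsto (fun N => ‖Q - Q * CStarMatrix.ofMatrix ((R N)ᴴ * R N) * Q‖) atTop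
      (𝓝 0) := by
    have h1 : Tendsto (fun N => Q - Q * CStarMatrix.ofMatrix ((R N)ᴴ * R N) * Q) atTop
        (𝓝 (Q - Q * Q * Q)) :=
      tendsto_const_nhds.sub ((tendsto_const_nhds.mul hlim).mul tendsto_const_nhds)
    rw [hQ.isIdempotentElem.eq, hQ.isIdempotentElem.eq, sub_self] at h1
    simpa using h1.norm
  obtain ⟨N, hN⟩ := (hlim2.eventually (gt_mem_nhds one_pos)).exists
  have hC : IsSelfAdjoint (CStarMatrix.ofMatrix ((R N)ᴴ * R N)) := by
    change ((R N)ᴴ * R N)ᴴ = (R N)ᴴ * R N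
    rw [Matrix.conjTranspose_mul, Matrix.conjTranspose_conjTranspose]
  -- The row `w = R N y q` then satisfies `w*w = q`, and `p w = 0` is inherited from `R N`, so `w
  -- w*` is the required projection.
  obtain ⟨Y, hY⟩ := exists_conj_eq_of_norm_lt hQ hC hN
  set y : Matrix (Fin m) (Fin m) A := CStarMatrix.ofMatrix.symm Y with hy
  have hy1 : yᴴ * ((R N)ᴴ * R N) * y = q := hY
  have hqq : q * q = q := hq.isIdempotentElem
  have hqs : qᴴ = q := hq.isSelfAdjoint
  set w := R N * (y * q) with hw
  have hww : wᴴ * w = q := by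
    calc wᴴ * w = qᴴ * (yᴴ * ((R N)ᴴ * R N) * y) * q := by
          rw [hw, Matrix.conjTranspose_mul, Matrix.conjTranspose_mul]; simp only [Matrix.mul_assoc]
      _ = q := by rw [hy1, hqs, hqq, hqq]
  obtain ⟨r, hr, hwr, hcls⟩ := exists_projection_of_row hq hww
    (by rw [hw, Matrix.mul_assoc, Matrix.mul_assoc, hqq])
  refine ⟨r, hr, ?_, hcls⟩
  have hpw : (Matrix.of fun _ _ : Fin 1 => p) * (w * wᴴ) = 0 := by
    have : (Matrix.of fun _ _ : Fin 1 => p) * R N = 0 := by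
      ext i j; simp [hR, Matrix.mul_apply, hpW]
    rw [← Matrix.mul_assoc, hw, ← Matrix.mul_assoc, this, Matrix.zero_mul, Matrix.zero_mul]
  rw [hwr] at hpw
  simpa [Matrix.mul_apply] using congrFun (congrFun hpw 0) 0

/-- Approximate `p` and the entries of `q` in one image of `M_n(A)`. In a larger matrix algebra the
columns of the approximant of `q` can be shifted below the corner of the approximant of `p`, without
changing their inner products. The shifted columns are almost annihilated by `p`, so subtracting `p
V` makes them exactly orthogonal in the limit argument of `exists_orthogonal_of_tendsto`. -/
theorem IsStable.exists_orthogonal (hA : IsStable A) {p : A} (hp : IsStarProjection p) {m : ℕ}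
    {q : Matrix (Fin m) (Fin m) A} (hq : IsStarProjection q) :
    ∃ (r : A) (hr : IsStarProjection r), p * r = 0 ∧ K0.cls₁ r hr = K0.cls q hq := by
  obtain ⟨φ, -, hφ, hd⟩ := hA
  have hφk : ∀ (k n : ℕ) (x : Matrix (Fin n) (Fin n) A),
      φ (n + k) (dsum x (0 : Matrix (Fin k) (Fin k) A)) = φ n x := by
    intro k n x
    induction k with
    | zero =>
      congr 1
      ext i j
      exact dsum_apply_castAdd x (0 : Matrix (Fin 0) (Fin 0) A) i j
    | succ k ih =>
      rw [← dsum_zero_assoc]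
      exact (hφ _ _).trans ih
  have happrox : ∀ {ι : Type} [Fintype ι] (a : ι → A) (ε : ℝ), 0 < ε →
      ∃ (n : ℕ) (c : ι → Matrix (Fin n) (Fin n) A), ∀ i, ‖φ n (c i) - a i‖ < ε := by
    intro ι _ a ε hε
    have h1 : ∀ i, ∃ (n : ℕ) (c : Matrix (Fin n) (Fin n) A), ‖φ n c - a i‖ < ε := by
      intro i
      obtain ⟨b, hb, hab⟩ := Metric.mem_closure_iff.1 (hd (a i)) ε hε
      obtain ⟨n, c, rfl⟩ := Set.mem_iUnion.1 hb
      exact ⟨n, c, by rwa [dist_eq_norm, norm_sub_rev] at hab⟩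
    choose n c hc using h1
    have hle : ∀ i, n i ≤ Finset.univ.sup n := fun i => Finset.le_sup (Finset.mem_univ i)
    have h2 : ∀ i, ∃ c' : Matrix (Fin (Finset.univ.sup n)) (Fin (Finset.univ.sup n)) A,
        φ _ c' = φ _ (c i) := by
      intro i
      obtain ⟨k, hk⟩ := Nat.exists_eq_add_of_le (hle i)
      rw [hk]
      exact ⟨_, hφk k _ (c i)⟩
    choose c' hc' using h2
    exact ⟨_, c', fun i => by rw [hc']; exact hc i⟩
  have hstep : ∀ N : ℕ, ∃ (n : ℕ) (b : Matrix (Fin n) (Fin n) A)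
      (c : Fin m → Fin m → Matrix (Fin n) (Fin n) A),
      ‖φ n b - p‖ < 1 / ((N : ℝ) + 1) ∧ ∀ i j, ‖φ n (c i j) - q i j‖ < 1 / ((N : ℝ) + 1) := by
    intro N
    -- Indexing by `Option` puts `p` into one family with the entries of `q`, so that they share the
    -- size `n`.
    obtain ⟨n, c, hc⟩ := happrox (fun x : Option (Fin m × Fin m) =>
      x.elim p fun ij => q ij.1 ij.2) (1 / ((N : ℝ) + 1)) (by positivity)
    exact ⟨n, c none, fun i j => c (some (i, j)), hc none, fun i j => hc (some (i, j))⟩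
  choose n b c hb hc using hstep
  -- the columns of the approximants of `q`, moved off the corner of the approximants of `p`
  have hV : ∀ N, ∃ V : Fin m → A, (∀ j, φ (n N) (b N) * V j = 0) ∧
      ∀ j k, star (V j) * V k = ∑ i, star (φ (n N) (c N i j)) * φ (n N) (c N i k) := by
    intro N
    -- `K j` stacks the approximants of the `j`-th column of `q`. As the lower left block it is
    -- killed from the left by the upper left corner.
    set K : Fin m → Matrix (Fin (m * n N)) (Fin (n N)) A := fun j =>
      Matrix.of fun ik l => c N (finProdFinEquiv.symm ik).1 j (finProdFinEquiv.symm ik).2 l with hK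
    have hKK : ∀ j k, (K j)ᴴ * K k = ∑ i, (c N i j)ᴴ * c N i k := by
      intro j k
      ext x y
      rw [Matrix.mul_apply, Matrix.sum_apply]
      rw [← finProdFinEquiv.sum_comp, Fintype.sum_prod_type]
      refine Finset.sum_congr rfl fun i _ => ?_
      rw [Matrix.mul_apply]
      refine Finset.sum_congr rfl fun l _ => ?_
      simp only [hK, Matrix.conjTranspose_apply, Matrix.of_apply, Equiv.symm_apply_apply]
    refine ⟨fun j => φ (n N + m * n N) (Matrix.reindex finSumFinEquiv finSumFinEquiv
      (Matrix.fromBlocks 0 0 (K j) 0)), fun j => ?_, fun j k => ?_⟩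
    · rw [← hφk (m * n N), ← map_mul, dsum, Matrix.reindex_apply, Matrix.reindex_apply,
        Matrix.submatrix_mul_equiv, Matrix.fromBlocks_multiply]
      simp
    · have h1 : star (Matrix.reindex finSumFinEquiv finSumFinEquiv
          (Matrix.fromBlocks (0 : Matrix (Fin (n N)) (Fin (n N)) A) 0 (K j) 0)) *
          (Matrix.reindex finSumFinEquiv finSumFinEquiv
          (Matrix.fromBlocks (0 : Matrix (Fin (n N)) (Fin (n N)) A) 0 (K k) 0)) =
          dsum ((K j)ᴴ * K k) (0 : Matrix (Fin (m * n N)) (Fin (m * n N)) A) := by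
        rw [Matrix.star_eq_conjTranspose, Matrix.conjTranspose_reindex, dsum,
          Matrix.reindex_apply, Matrix.reindex_apply, Matrix.reindex_apply,
          Matrix.submatrix_mul_equiv, Matrix.fromBlocks_conjTranspose, Matrix.fromBlocks_multiply]
        simp
      rw [← map_star, ← map_mul, h1, hφk, hKK, map_sum]
      refine Finset.sum_congr rfl fun i _ => ?_
      rw [map_mul, ← Matrix.star_eq_conjTranspose, map_star]
  choose V hV0 hV1 using hV
  have hbl : Tendsto (fun N => φ (n N) (b N)) atTop (𝓝 p) := by
    refine tendsto_iff_norm_sub_tendsto_zero.2 ?_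
    exact squeeze_zero (fun _ => norm_nonneg _) (fun N => (hb N).le)
      tendsto_one_div_add_atTop_nhds_zero_nat
  have hcl : ∀ i j, Tendsto (fun N => φ (n N) (c N i j)) atTop (𝓝 (q i j)) := by
    intro i j
    refine tendsto_iff_norm_sub_tendsto_zero.2 ?_
    exact squeeze_zero (fun _ => norm_nonneg _) (fun N => (hc N i j).le)
      tendsto_one_div_add_atTop_nhds_zero_nat
  have hVV : ∀ j k, Tendsto (fun N => star (V N j) * V N k) atTop (𝓝 (q j k)) := by
    intro j k
    have h1 : q j k = ∑ i, star (q i j) * q i k := by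
      have : qᴴ * q = q := by
        rw [(isStarProjection_iff_conj.1 hq).2, (isStarProjection_iff_conj.1 hq).1]
      conv_lhs => rw [← this]
      simp [Matrix.mul_apply]
    rw [h1]
    simp only [hV1]
    exact tendsto_finsetSum _ fun i _ => ((hcl i j).star).mul (hcl i k)
  have hVn : ∀ j, Tendsto (fun N => ‖V N j‖) atTop (𝓝 (√‖q j j‖)) := by
    intro j
    have h1 := ((hVV j j).norm).sqrt
    refine h1.congr fun N => ?_
    rw [CStarRing.norm_star_mul_self, Real.sqrt_mul_self (norm_nonneg _)]
  have hpV : ∀ j k, Tendsto (fun N => star (V N j) * (p * V N k)) atTop (𝓝 0) := by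
    intro j k
    have h1 : Tendsto (fun N => ‖V N j‖ * (‖p - φ (n N) (b N)‖ * ‖V N k‖)) atTop (𝓝 0) := by
      have h2 : Tendsto (fun N => ‖p - φ (n N) (b N)‖) atTop (𝓝 0) := by
        have := (tendsto_const_nhds (x := p)).sub hbl
        rw [sub_self] at this
        simpa using this.norm
      have := (hVn j).mul (h2.mul (hVn k))
      simpa using this
    refine squeeze_zero_norm (fun N => ?_) h1
    -- The approximant of `p` annihilates `V`, so only its error acts, and the norms of `V`
    -- converge.
    have h3 : p * V N k = (p - φ (n N) (b N)) * V N k := by rw [sub_mul, hV0, sub_zero]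
    rw [h3]
    refine (norm_mul_le _ _).trans ?_
    rw [norm_star]
    gcongr
    exact norm_mul_le _ _
  refine exists_orthogonal_of_tendsto hq (W := fun N j => V N j - p * V N j) (fun N j => ?_)
    fun j k => ?_
  · rw [mul_sub, ← mul_assoc, hp.isIdempotentElem.eq, sub_self]
  · have h1 := (hVV j k).sub (hpV j k)
    rw [sub_zero] at h1
    refine h1.congr fun N => ?_
    rw [star_sub, star_mul, hp.isSelfAdjoint.star_eq, sub_mul, mul_sub, mul_sub,
      mul_assoc _ p (p * _), ← mul_assoc p p, hp.isIdempotentElem.eq, mul_assoc _ p, sub_self,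
      sub_zero]

/-- In a stable algebra a projection is contained in projections of every larger class. -/
theorem IsStable.exists_ge (hA : IsStable A) {p : A} (hp : IsStarProjection p) {x : K0 A}
    (hx : K0.cls₁ p hp ≤ x) :
    ∃ (q : A) (hq : IsStarProjection q), p * q = p ∧ K0.cls₁ q hq = x := by
  obtain ⟨m, q, hq, h1⟩ := K0.le_def.1 hx
  obtain ⟨r, hr, hpr, h2⟩ := hA.exists_orthogonal hp hq
  have h3 := isStarProjection_add_of_mul_eq_zero hp hr hpr
  refine ⟨p + r, h3, ?_, ?_⟩
  · rw [mul_add, hpr, hp.isIdempotentElem.eq, add_zero]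
  · rw [← K0.cls₁_add hp hr hpr, h2, h1]; abel

end Stable

/-! ### Estimates for singular value functions -/

section Estimates

variable {A : Type*} [NonUnitalCStarAlgebra A]

theorem s_le {a p : A} {g : K0.pos A} (hp : IsStarProjection p)
    (h : K0.cls₁ p hp ≤ (g : K0 A)) : (s a g : ℝ) ≤ ‖a - a * p‖ := by
  have : s a g ≤ ‖a - a * p‖₊ := csInf_le' ⟨p, hp, h, rfl⟩
  exact_mod_cast this

theorem le_s {a : A} {g : K0.pos A} {c : ℝ}
    (h : ∀ (p : A) (hp : IsStarProjection p), K0.cls₁ p hp ≤ (g : K0 A) → c ≤ ‖a - a * p‖) :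
    c ≤ s a g := by
  rcases le_total c 0 with hc | hc
  · exact hc.trans (s a g).2
  lift c to ℝ≥0 using hc
  -- The projection `0` shows that the infimum is over a nonempty set; the infimum of the empty set
  -- would be `0`.
  refine NNReal.coe_le_coe.2 (le_csInf ⟨_, 0, .zero A, ?_, rfl⟩ ?_)
  · rw [K0.cls₁_zero, K0.le_def, sub_zero]; exact g.2
  · rintro _ ⟨p, hp, hpg, rfl⟩
    exact_mod_cast h p hp hpg

theorem s_antitone (a : A) : Antitone (s a) := by
  intro g h hgh
  exact NNReal.coe_le_coe.1 (le_s fun p hp hpg => s_le hp (hpg.trans hgh))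

/-- A projection `p` with `[p] ≤ g` and `‖a - a p‖ < c` would dominate `e` up to equivalence,
forcing `[e] ≤ [p] ≤ g`. -/
theorem le_s_of_not_le [PartialOrder A] [StarOrderedRing A] {a e : A} {g : K0.pos A} {c : ℝ}
    (he : IsStarProjection e) (h1 : (c ^ 2) • e ≤ e * (star a * a) * e)
    (h2 : ¬ K0.cls₁ e he ≤ (g : K0 A)) : c ≤ s a g := by
  refine le_s fun p hp hpg => ?_
  by_contra! hlt
  refine h2 ((K0.cls₁_le_of_norm_lt he hp ?_).trans hpg)
  exact norm_sub_conj_lt_one he hp ((norm_nonneg _).trans_lt hlt) h1 hlt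

/-- The same projection is tested on `a` and `b`. The factor `2` comes from the triangle inequality
for `(a - b) - (a - b) p`. -/
theorem s_le_add (a b : A) (g : K0.pos A) : (s a g : ℝ) ≤ s b g + 2 * ‖a - b‖ := by
  rw [← sub_le_iff_le_add]
  refine le_s fun p hp hpg => ?_
  rw [sub_le_iff_le_add]
  refine (s_le hp hpg).trans ?_
  have h1 : a - a * p = (b - b * p) + ((a - b) - (a - b) * p) := by rw [sub_mul]; abel
  have h2 : ‖(a - b) * p‖ ≤ ‖a - b‖ :=
    (norm_mul_le _ _).trans (mul_le_of_le_one_right (norm_nonneg _) (IsStarProjection.norm_le p hp))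
  calc ‖a - a * p‖ ≤ ‖b - b * p‖ + ‖(a - b) - (a - b) * p‖ := by rw [h1]; exact norm_add_le _ _
    _ ≤ ‖b - b * p‖ + (‖a - b‖ + ‖a - b‖) := by
        gcongr
        exact (norm_sub_le _ _).trans (add_le_add_right h2 _)
    _ = _ := by ring

end Estimates

/-! ### Levels of a decreasing function on `K_0(A)^+` -/

section Levels

variable {A : Type*} [NonUnitalCStarAlgebra A]

/-- The decreasing function `f` passes the value `l` at the point `x`. -/
def IsLevel (f : K0.pos A → ℝ≥0) (l : ℝ) (x : K0.pos A) : Prop :=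
  (∀ y, x ≤ y → (f y : ℝ) ≤ l) ∧ ∀ y, ¬ x ≤ y → l ≤ f y

theorem IsLevel.le_of_lt {f : K0.pos A → ℝ≥0} {l l' : ℝ} {x x' : K0.pos A} (h : IsLevel f l x)
    (h' : IsLevel f l' x') (hl : l < l') : x' ≤ x := by
  by_contra hx
  exact absurd ((h'.2 _ hx).trans (h.1 _ le_rfl)) (not_le.2 hl)

/-- A positive class, as a point of the cone of the half-line. -/
def RealEmbedding.point (j : RealEmbedding A) (g : K0.pos A) : j.cone := ⟨j.incl g, g, rfl⟩

theorem RealEmbedding.push_point (j : RealEmbedding A) (f : K0.pos A → ℝ≥0) (g : K0.pos A) :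
    j.push f (j.point g) = f g := by
  rw [RealEmbedding.push]
  congr 1
  exact (Equiv.ofInjective j.incl j.incl_injective).symm_apply_apply g

theorem RealEmbedding.exists_point_eq (j : RealEmbedding A) (z : j.cone) :
    ∃ g, j.point g = z := by
  obtain ⟨_, g, rfl⟩ := z
  exact ⟨g, rfl⟩

theorem RealEmbedding.incl_zero (j : RealEmbedding A) : j.incl 0 = 0 :=
  Subtype.ext (map_zero j.toHom)

theorem RealEmbedding.zero_mem_cone (j : RealEmbedding A) : (0 : ℝ≥0) ∈ j.cone :=
  ⟨0, j.incl_zero⟩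

theorem K0.pos_zero_le (g : K0.pos A) : 0 ≤ g := by
  change (0 : K0 A) ≤ (g : K0 A)
  rw [K0.le_def, sub_zero]; exact g.2

/-- The levels are dense between `0` and `f 0`. -/
theorem exists_isLevel (j : RealEmbedding A) {f : K0.pos A → ℝ≥0} (hf : Antitone f)
    (hrc : RightCts (j.push f)) (hdp : DP (ext (j.push f)) ⊆ j.cone) {u v : ℝ≥0}
    (huv : u < v) (hu : ∃ y, f y < u) :
    ∃ (l : ℝ≥0) (x : K0.pos A), u ≤ l ∧ l ≤ v ∧ IsLevel f l x := by
  -- A value of `f` in `[u, v]` is itself a level. Otherwise `f` jumps over `[u, v]`, and `τ` is the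
  -- place of the jump.
  by_cases hA : ∃ x, u ≤ f x ∧ f x ≤ v
  · obtain ⟨x, h1, h2⟩ := hA
    refine ⟨f x, x, h1, h2, fun y hy => NNReal.coe_le_coe.2 (hf hy), fun y hy => ?_⟩
    exact NNReal.coe_le_coe.2 (hf (j.incl_le_iff.1 (j.incl_lt_iff.2 hy).le))
  push Not at hA
  set τ : ℝ≥0 := sInf (j.incl '' {y | f y < u}) with hτ
  have hne : (j.incl '' {y | f y < u}).Nonempty := Set.Nonempty.image _ hu
  have hle : ∀ y, f y < u → τ ≤ j.incl y := fun y hy => csInf_le' ⟨y, hy, rfl⟩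
  have hlt : ∀ y, j.incl y < τ → v < f y := fun y hy =>
    hA y (not_lt.1 fun h => absurd (hle y h) (not_le.2 hy))
  by_cases hmin : ∃ x, f x < u ∧ j.incl x = τ
  · obtain ⟨x, hx, hxτ⟩ := hmin
    refine ⟨u, x, le_rfl, huv.le, fun y hy => NNReal.coe_le_coe.2 ((hf hy).trans hx.le),
      fun y hy => NNReal.coe_le_coe.2 (huv.le.trans (hlt y ?_).le)⟩
    rw [← hxτ]; exact j.incl_lt_iff.2 hy
  push Not at hmin
  have hgt : ∀ d, τ < d → ∃ y, f y < u ∧ τ < j.incl y ∧ j.incl y < d := by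
    intro d hd
    obtain ⟨_, ⟨y, hy, rfl⟩, hyd⟩ := exists_lt_of_csInf_lt hne hd
    exact ⟨y, hy, lt_of_le_of_ne (hle y hy) (hmin y hy).symm, hyd⟩
  exfalso
  -- Without a first point where `f < u`, such points accumulate at `τ` from the right. If `τ` is in
  -- the cone, this contradicts right-continuity, as `f > v` there. If not, the extension is at most
  -- `u` at `τ` and at least `v` to its left, so `τ` is a jump point outside the cone.
  by_cases hτc : τ ∈ j.cone
  · obtain ⟨x, hx⟩ := hτc
    have hvx : v < f x := hA x (not_lt.1 fun h => hmin x h hx)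
    have h1 : {z : j.cone | v < j.push f z} ∈ nhdsWithin (j.point x) (Set.Ici (j.point x)) := by
      refine hrc (j.point x) (lt_mem_nhds ?_)
      rwa [j.push_point]
    obtain ⟨ε, hε, hball⟩ := Metric.mem_nhdsWithin_iff.1 h1
    obtain ⟨y, hy, hy1, hy2⟩ := hgt (τ + ⟨ε, hε.le⟩) (lt_add_of_pos_right _ hε)
    have h2 : j.point y ∈ {z : j.cone | v < j.push f z} := by
      refine hball ⟨?_, ?_⟩
      · rw [Metric.mem_ball, Subtype.dist_eq, NNReal.dist_eq]
        rw [← hx] at hy1 hy2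
        have e1 : (j.incl x : ℝ) < j.incl y := hy1
        have e2 : (j.incl y : ℝ) < j.incl x + ε := hy2
        change |(j.incl y : ℝ) - j.incl x| < ε
        rw [abs_lt]; constructor <;> linarith
      · change j.incl x ≤ j.incl y
        rw [hx]; exact hy1.le
    have h3 : v < j.push f (j.point y) := h2
    rw [j.push_point] at h3
    exact absurd (h3.trans (hy.trans huv)) (lt_irrefl _)
  · refine hτc (hdp ?_)
    have hcl : τ ∈ closure (j.cone ∩ Set.Ioi τ) := by
      rw [Metric.mem_closure_iff]
      intro ε hε
      obtain ⟨y, -, hy1, hy2⟩ := hgt (τ + ⟨ε, hε.le⟩) (lt_add_of_pos_right _ hε)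
      refine ⟨j.incl y, ⟨⟨y, rfl⟩, hy1⟩, ?_⟩
      have e1 : (τ : ℝ) < j.incl y := hy1
      have e2 : (j.incl y : ℝ) < τ + ε := hy2
      rw [NNReal.dist_eq, abs_lt]; constructor <;> linarith
    have hτ0 : τ ≠ 0 := fun h => hτc (h ▸ j.zero_mem_cone)
    refine ⟨closure_mono Set.inter_subset_left hcl, hτ0, ?_⟩
    have hup : ext (j.push f) ⟨τ, closure_mono Set.inter_subset_left hcl⟩ ≤ u := by
      rw [ext, dif_neg hτc, if_pos hcl, rightVal]
      refine csSup_le' ?_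
      rintro _ ⟨z, hz, rfl⟩
      obtain ⟨g, rfl⟩ := j.exists_point_eq z
      obtain ⟨y, hy, -, hy2⟩ := hgt (j.incl g) hz
      rw [j.push_point]
      exact (hf (j.incl_le_iff.1 hy2.le)).trans hy.le
    refine hup.trans_lt (huv.trans_le (le_csInf ?_ ?_))
    · exact ⟨_, ⟨0, subset_closure j.zero_mem_cone⟩, Or.inr rfl, rfl⟩
    rintro _ ⟨⟨y, hy⟩, hyτ, rfl⟩
    have hyτ' : y < τ := by
      rcases hyτ with h | h
      · exact h
      · exact (show y = 0 from h) ▸ pos_iff_ne_zero.2 hτ0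
    rw [ext]
    split_ifs with h1 h2
    · obtain ⟨g, hg⟩ := j.exists_point_eq ⟨y, h1⟩
      have hgy : j.incl g = y := congrArg Subtype.val hg
      refine le_trans (hlt g (hgy ▸ hyτ')).le ?_
      rw [← j.push_point f g, hg]
    · obtain ⟨z, hzτ, hz, hyz⟩ := mem_closure_iff.1 h2 (Set.Iio τ) isOpen_Iio hyτ'
      obtain ⟨g, hg⟩ := j.exists_point_eq ⟨z, hz⟩
      have hgz : j.incl g = z := congrArg Subtype.val hg
      refine (hlt g (hgz ▸ hzτ)).le.trans ?_
      -- The bound `f 0` is needed because an unbounded supremum in `ℝ≥0` is `0`.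
      refine le_csSup ⟨f 0, ?_⟩ ⟨⟨z, hz⟩, hyz, ?_⟩
      · rintro _ ⟨w, -, rfl⟩
        obtain ⟨h, rfl⟩ := j.exists_point_eq w
        rw [j.push_point]
        exact hf (K0.pos_zero_le h)
      · rw [← hg, j.push_point]
    · refine le_csInf ⟨_, ⟨0, j.zero_mem_cone⟩, Or.inr rfl, rfl⟩ ?_
      rintro _ ⟨w, hw, rfl⟩
      obtain ⟨g, rfl⟩ := j.exists_point_eq w
      rw [j.push_point]
      refine (hlt g ?_).le
      rcases hw with h | h
      · exact lt_trans h hyτ'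
      · exact (show j.incl g = 0 from h) ▸ pos_iff_ne_zero.2 hτ0

end Levels

/-! ### Regularity of singular value functions in real rank zero -/

section Regularity

variable {A : Type*} [NonUnitalCStarAlgebra A]

/-- In real rank zero, singular value functions cross every nondegenerate interval of values at an
element of the positive cone. -/
theorem RealRankZero.exists_crossing (hA : RealRankZero A) (a : A) {c d : ℝ≥0} (hc : 0 < c)
    (hcd : c < d) :
    ∃ x : K0.pos A, (∀ h, x ≤ h → s a h ≤ d) ∧ ∀ h, ¬ x ≤ h → c ≤ s a h := by
  let _ := CStarAlgebra.spectralOrder A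
  have _ := CStarAlgebra.spectralOrderedRing A
  have hc' : (0 : ℝ) < c := hc
  have hcd' : (c : ℝ) < d := hcd
  -- These solve `t + η = d²` and `t - η = c²`; `η < t` amounts to `c ≠ 0`.
  obtain ⟨e, he, h1, h2⟩ := hA.exists_spectral_projection a
    (t := ((c : ℝ) ^ 2 + (d : ℝ) ^ 2) / 2) (η := ((d : ℝ) ^ 2 - (c : ℝ) ^ 2) / 2)
    (by nlinarith) (by nlinarith)
  have e1 : ((c : ℝ) ^ 2 + (d : ℝ) ^ 2) / 2 + ((d : ℝ) ^ 2 - (c : ℝ) ^ 2) / 2 = (d : ℝ) ^ 2 := by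
    ring
  have e2 : ((c : ℝ) ^ 2 + (d : ℝ) ^ 2) / 2 - ((d : ℝ) ^ 2 - (c : ℝ) ^ 2) / 2 = (c : ℝ) ^ 2 := by
    ring
  rw [e1] at h1
  rw [e2] at h2
  refine ⟨K0.posCls₁ e he, fun h hh => ?_, fun h hh => ?_⟩
  · refine NNReal.coe_le_coe.1 ((s_le he hh).trans ?_)
    exact (sq_le_sq₀ (norm_nonneg _) d.2).1 h1
  · exact NNReal.coe_le_coe.1 (le_s_of_not_le he h2 hh)

theorem RealRankZero.vanishesAtInfty_s (hA : RealRankZero A) (a : A) : VanishesAtInfty (s a) := by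
  intro ε hε
  obtain ⟨d, hd0, hdε⟩ := exists_between hε
  obtain ⟨c, hc0, hcd⟩ := exists_between hd0
  obtain ⟨x, hx, -⟩ := hA.exists_crossing a hc0 hcd
  exact ⟨x, fun y hy => (hx y hy).trans_lt hdε⟩

/-- Monotonicity gives the upper estimate. For the lower one take `l < c < d < s_g`: the crossing
point of `(c, d)` lies strictly above `g`, and up to it all values are at least `c`. -/
theorem RealRankZero.rightCts_s (hA : RealRankZero A) (j : RealEmbedding A) (a : A) :
    RightCts (j.push (s a)) := by
  intro z
  obtain ⟨g, rfl⟩ := j.exists_point_eq z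
  refine tendsto_order.2 ⟨fun l hl => ?_, fun u hu => ?_⟩
  · rw [j.push_point] at hl
    obtain ⟨c, hlc, hc⟩ := exists_between hl
    obtain ⟨d, hcd, hd⟩ := exists_between hc
    obtain ⟨x, hx1, hx2⟩ := hA.exists_crossing a (pos_of_gt hlc) hcd
    have hgx : j.incl g < j.incl x := j.incl_lt_iff.2 fun h => absurd (hx1 g h) (not_le.2 hd)
    have hmem : {w : j.cone | (w : ℝ≥0) < j.incl x} ∈ nhds (j.point g) :=
      (isOpen_Iio.preimage continuous_subtype_val).mem_nhds hgx
    filter_upwards [mem_nhdsWithin_of_mem_nhds hmem] with w hw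
    obtain ⟨h, rfl⟩ := j.exists_point_eq w
    rw [j.push_point]
    exact hlc.trans_le (hx2 h (j.incl_lt_iff.1 hw))
  · rw [j.push_point] at hu
    filter_upwards [self_mem_nhdsWithin] with w hw
    obtain ⟨h, rfl⟩ := j.exists_point_eq w
    rw [j.push_point]
    exact (s_antitone a (j.incl_le_iff.1 hw)).trans_lt hu

/-- Let `x` be a jump outside the cone. If the cone accumulates at `x` from the right, a crossing
point for values inside the jump must lie above `x`, and the cone points in between have values too
large for the right limit. Otherwise the extension takes its left limit at `x`, so there is no jump.
-/
theorem RealRankZero.dp_subset (hA : RealRankZero A) (j : RealEmbedding A) (a : A) :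
    DP (ext (j.push (s a))) ⊆ j.cone := by
  rintro x ⟨hx, -, hlt⟩
  by_contra hxc
  have hext : ∀ w : j.cone, ∀ hw : (w : ℝ≥0) ∈ closure j.cone,
      ext (j.push (s a)) ⟨w, hw⟩ = j.push (s a) w := fun w hw => by
    rw [ext, dif_pos w.2]
  have hL : ∀ w : j.cone, ((w : ℝ≥0) < x ∨ (w : ℝ≥0) = 0) →
      leftVal (ext (j.push (s a))) x ≤ j.push (s a) w := by
    intro w hw
    rw [← hext w (subset_closure w.2)]
    exact csInf_le' ⟨⟨w, subset_closure w.2⟩, hw, rfl⟩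
  by_cases hacc : x ∈ closure (j.cone ∩ Set.Ioi x)
  · obtain ⟨c, hc1, hc⟩ := exists_between hlt
    obtain ⟨d, hcd, hd⟩ := exists_between hc
    obtain ⟨y, hy1, hy2⟩ := hA.exists_crossing a (pos_of_gt hc1) hcd
    have hxy : x < j.incl y := by
      refine lt_of_le_of_ne (not_lt.1 fun h => ?_) fun h => hxc (h ▸ ⟨y, rfl⟩)
      have := hL (j.point y) (Or.inl h)
      rw [j.push_point] at this
      exact absurd (this.trans (hy1 y le_rfl)) (not_le.2 hd)
    obtain ⟨z, hzy, hz, hxz⟩ := mem_closure_iff.1 hacc (Set.Iio (j.incl y)) isOpen_Iio hxy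
    obtain ⟨g, hg⟩ := j.exists_point_eq ⟨z, hz⟩
    have hgz : j.incl g = z := congrArg Subtype.val hg
    rw [ext, dif_neg hxc, if_pos hacc] at hc1
    refine absurd hc1 (not_lt.2 ((hy2 g (j.incl_lt_iff.1 (hgz ▸ hzy))).trans ?_))
    refine le_csSup ⟨s a 0, ?_⟩ ⟨⟨z, hz⟩, hxz, ?_⟩
    · rintro _ ⟨w, -, rfl⟩
      obtain ⟨h, rfl⟩ := j.exists_point_eq w
      rw [j.push_point]
      exact s_antitone a (K0.pos_zero_le h)
    · rw [← hg, j.push_point]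
  · rw [ext, dif_neg hxc, if_neg hacc] at hlt
    refine absurd hlt (not_lt.2 (le_csInf ⟨_, ⟨0, j.zero_mem_cone⟩, Or.inr rfl, rfl⟩ ?_))
    rintro _ ⟨w, hw, rfl⟩
    exact hL w hw

end Regularity

/-! ### Realization of functions as singular value functions -/

section Realization

open Filter Topology Finset

variable {A : Type*} [NonUnitalCStarAlgebra A]

/-- The sum lies between `0` and `d` times the projection `∑ E k`. -/
theorem norm_sum_smul_projections_le {E : ℕ → A} (hE : ∀ k, IsStarProjection (E k))
    (horth : ∀ i k, i < k → E k * E i = 0) {c : ℕ → ℝ} {d : ℝ} (hc : ∀ k, 0 ≤ c k)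
    (hcd : ∀ k, c k ≤ d) (N : ℕ) : ‖∑ k ∈ range N, c k • E k‖ ≤ d := by
  let _ := CStarAlgebra.spectralOrder A
  have _ := CStarAlgebra.spectralOrderedRing A
  have hd : 0 ≤ d := (hc 0).trans (hcd 0)
  have hproj : ∀ N, IsStarProjection (∑ k ∈ range N, E k) := by
    intro N
    induction N with
    | zero => simp
    | succ N ih =>
      rw [sum_range_succ]
      refine isStarProjection_add_of_mul_eq_zero ih (hE N) ?_
      rw [sum_mul]
      refine sum_eq_zero fun i hi => ?_
      exact isStarProjection_mul_eq_zero_symm (hE N) (hE i) (horth i N (mem_range.1 hi))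
  have h1 : ∑ k ∈ range N, c k • E k ≤ d • ∑ k ∈ range N, E k := by
    rw [smul_sum]
    exact sum_le_sum fun k _ => smul_le_smul_of_nonneg_right (hcd k) (hE k).nonneg
  have h0 : 0 ≤ ∑ k ∈ range N, c k • E k :=
    sum_nonneg fun k _ => smul_nonneg (hc k) (hE k).nonneg
  refine (CStarAlgebra.norm_le_norm_of_nonneg_of_le h0 h1).trans ?_
  rw [norm_smul, Real.norm_of_nonneg hd]
  exact mul_le_of_le_one_right hd (IsStarProjection.norm_le _ (hproj N))

/-- A step approximation of a decreasing function `f` on `K_0(A)^+`: an increasing sequence of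
values `l 0 = 0, l 1, …, l N = f 0 = l (N + 1) = ⋯` with gaps at most `d`, together with a
decreasing sequence of projections at whose classes `f` passes these values. -/
structure StepApprox (f : K0.pos A → ℝ≥0) (d : ℝ) (N : ℕ) (l : ℕ → ℝ) (Q : ℕ → A) : Prop where
  pos : 0 < N
  zero : l 0 = 0
  mono : ∀ k, l k ≤ l (k + 1)
  gap : ∀ k, l (k + 1) ≤ l k + d
  top : ∀ k, N ≤ k → l k = f 0
  proj : ∀ k, IsStarProjection (Q k)
  mul : ∀ k, Q (k + 1) * Q k = Q (k + 1)
  bot : ∀ k, N ≤ k + 1 → Q k = 0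
  level : ∀ k, IsLevel f (l (k + 1)) (K0.posCls₁ (Q k) (proj k))

/-- The element with spectral values `l` and spectral projections `Q`. -/
def stepElement (N : ℕ) (l : ℕ → ℝ) (Q : ℕ → A) : A := ∑ k ∈ range N, (l (k + 1) - l k) • Q k

namespace StepApprox

variable {f : K0.pos A → ℝ≥0} {d : ℝ} {N : ℕ} {l : ℕ → ℝ} {Q : ℕ → A}

theorem monotone (h : StepApprox f d N l Q) : Monotone l := monotone_nat_of_le_succ h.mono

theorem mul_of_le (h : StepApprox f d N l Q) {i k : ℕ} (hik : i ≤ k) : Q k * Q i = Q k := by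
  induction k, hik using Nat.le_induction with
  | base => exact (h.proj i).isIdempotentElem
  | succ k _ ih => rw [← h.mul k, mul_assoc, ih]

theorem mul_of_le' (h : StepApprox f d N l Q) {i k : ℕ} (hik : i ≤ k) : Q i * Q k = Q k :=
  isStarProjection_mul_eq_symm (h.proj k) (h.proj i) (h.mul_of_le hik)

theorem le_top (h : StepApprox f d N l Q) (k : ℕ) : l k ≤ f 0 := by
  rw [← h.top (max k N) (le_max_right _ _)]
  exact h.monotone (le_max_left _ _)

theorem nonneg (h : StepApprox f d N l Q) (k : ℕ) : 0 ≤ l k := by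
  rw [← h.zero]; exact h.monotone (Nat.zero_le k)

/-- The terms with `i ≥ k` live under `Q k` and cancel; the coefficients of the others telescope to
`l k`. -/
theorem norm_sub_mul_le (h : StepApprox f d N l Q) (k : ℕ) :
    ‖stepElement N l Q - stepElement N l Q * Q k‖ ≤ l k := by
  have h1 : stepElement N l Q - stepElement N l Q * Q k =
      ∑ i ∈ range N, (l (i + 1) - l i) • (Q i - Q i * Q k) := by
    rw [stepElement, sum_mul, ← sum_sub_distrib]
    refine sum_congr rfl fun i _ => ?_
    rw [smul_sub, smul_mul_assoc]
  have h2 : ∀ i, ‖(l (i + 1) - l i) • (Q i - Q i * Q k)‖ ≤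
      if i < k then l (i + 1) - l i else 0 := by
    intro i
    split_ifs with hi
    · rw [h.mul_of_le' hi.le, norm_smul, Real.norm_of_nonneg (sub_nonneg.2 (h.mono i))]
      exact mul_le_of_le_one_right (sub_nonneg.2 (h.mono i)) (IsStarProjection.norm_le _
        (isStarProjection_sub_of_mul_eq (h.proj k) (h.proj i) (h.mul_of_le hi.le)))
    · rw [h.mul_of_le (not_lt.1 hi), sub_self, smul_zero, norm_zero]
  rw [h1]
  refine (norm_sum_le_of_le _ fun i _ => h2 i).trans ?_
  rw [← sum_filter]
  calc _ ≤ ∑ i ∈ range k, (l (i + 1) - l i) := by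
        refine sum_le_sum_of_subset_of_nonneg (fun i hi => ?_) fun i _ _ => sub_nonneg.2 (h.mono i)
        exact mem_range.2 (mem_filter.1 hi).2
    _ = l k := by rw [sum_range_sub, h.zero, sub_zero]

/-- On the range of `Q k` the element is `l (k + 1) Q k` plus a positive `b` supported there, so its
square is at least `l (k + 1)² Q k`. -/
theorem smul_le_conj [PartialOrder A] [StarOrderedRing A] (h : StepApprox f d N l Q) (k : ℕ) :
    (l (k + 1) ^ 2) • Q k ≤
      Q k * (star (stepElement N l Q) * stepElement N l Q) * Q k := by
  -- For `k ≥ N - 1` the projection is `0`; below that, `range (k + 1)` is inside `range N`.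
  rcases le_or_gt N (k + 1) with hk | hk
  · rw [h.bot k hk]; simp
  set b := ∑ i ∈ range N, (if k < i then (l (i + 1) - l i) • Q i else 0) with hb
  have hΔ : ∀ i, 0 ≤ l (i + 1) - l i := fun i => sub_nonneg.2 (h.mono i)
  have h1 : stepElement N l Q * Q k = l (k + 1) • Q k + b := by
    have h2 : l (k + 1) • Q k =
        ∑ i ∈ range N, (if ¬ k < i then (l (i + 1) - l i) • Q k else 0) := by
      have h3 : (range N).filter (fun i => ¬ k < i) = range (k + 1) := by
        ext i; simp only [mem_filter, mem_range]; omega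
      rw [← sum_filter, h3, ← sum_smul, sum_range_sub, h.zero, sub_zero]
    rw [h2, hb, ← sum_add_distrib, stepElement, sum_mul]
    refine sum_congr rfl fun i _ => ?_
    rw [smul_mul_assoc]
    by_cases hi : k < i
    · rw [if_neg (not_not.2 hi), if_pos hi, h.mul_of_le hi.le, zero_add]
    · rw [if_pos hi, if_neg hi, h.mul_of_le' (not_lt.1 hi), add_zero]
  have hb0 : 0 ≤ b := by
    refine sum_nonneg fun i _ => ?_
    split_ifs
    · exact smul_nonneg (hΔ i) (h.proj i).nonneg
    · exact le_rfl
  have hbs : star b = b := hb0.isSelfAdjoint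
  have hbQ : b * Q k = b := by
    rw [hb, sum_mul]
    refine sum_congr rfl fun i _ => ?_
    split_ifs with hi
    · rw [smul_mul_assoc, h.mul_of_le hi.le]
    · rw [zero_mul]
  have hQs : star (Q k) = Q k := (h.proj k).isSelfAdjoint
  have hQb : Q k * b = b := by
    have := congrArg star hbQ
    rwa [star_mul, hbs, hQs] at this
  have h4 : Q k * (star (stepElement N l Q) * stepElement N l Q) * Q k =
      star (stepElement N l Q * Q k) * (stepElement N l Q * Q k) := by
    rw [star_mul, hQs]; simp only [mul_assoc]
  have h5 : star (stepElement N l Q * Q k) * (stepElement N l Q * Q k) =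
      (l (k + 1) ^ 2) • Q k + ((2 * l (k + 1)) • b + star b * b) := by
    rw [h1, star_add, star_smul, hQs, hbs, star_trivial]
    simp only [add_mul, mul_add, smul_mul_assoc, mul_smul_comm, hQb, hbQ, smul_add, smul_smul,
      (h.proj k).isIdempotentElem.eq, two_mul, add_smul, pow_two]
    abel
  rw [h4, h5]
  refine le_add_of_nonneg_right (add_nonneg (smul_nonneg ?_ hb0) (star_mul_self_nonneg b))
  exact mul_nonneg zero_le_two (h.nonneg _)

/-- For the first `k` with `[Q k] ≤ g`, both `s_g` and `f g` lie between `l k` and `l (k + 1)`. The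
failure at `k - 1` gives the lower bounds; for `k = 0` they are trivial since `l 0 = 0`. -/
theorem abs_s_sub_le (h : StepApprox f d N l Q) (g : K0.pos A) :
    |(s (stepElement N l Q) g : ℝ) - f g| ≤ d := by
  classical
  let _ := CStarAlgebra.spectralOrder A
  have _ := CStarAlgebra.spectralOrderedRing A
  have hex : ∃ k, K0.cls₁ (Q k) (h.proj k) ≤ (g : K0 A) := by
    refine ⟨N, ?_⟩
    have h0 : ∀ (p : A) (hp : IsStarProjection p), p = 0 → K0.cls₁ p hp ≤ (g : K0 A) := by
      rintro p hp rfl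
      rw [K0.cls₁_zero]; exact K0.pos_zero_le g
    exact h0 _ _ (h.bot N (Nat.le_succ N))
  obtain ⟨k, hk, hmin⟩ : ∃ k, K0.cls₁ (Q k) (h.proj k) ≤ (g : K0 A) ∧
      ∀ i < k, ¬ K0.cls₁ (Q i) (h.proj i) ≤ (g : K0 A) :=
    ⟨Nat.find hex, Nat.find_spec hex, fun i hi => Nat.find_min hex hi⟩
  have h1 : (s (stepElement N l Q) g : ℝ) ≤ l k := (s_le _ hk).trans (h.norm_sub_mul_le k)
  have h2 : (f g : ℝ) ≤ l (k + 1) := (h.level k).1 g hk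
  have h3 : l k ≤ s (stepElement N l Q) g ∧ l k ≤ f g := by
    cases k with
    | zero => rw [h.zero]; exact ⟨(s _ g).2, (f g).2⟩
    | succ i =>
      exact ⟨le_s_of_not_le (h.proj i) (h.smul_le_conj i) (hmin i i.lt_succ_self),
        (h.level i).2 g (hmin i i.lt_succ_self)⟩
  have h4 := h.gap k
  have h5 := h.mono k
  rw [abs_le]; constructor <;> linarith [h3.1, h3.2]

/-- Pairing the terms of the refined sum leaves a combination of the mutually orthogonal differences
`Q' (2k) - Q' (2k+1)`, with coefficients at most `d'`. -/
theorem norm_stepElement_sub_le {d' : ℝ} {N' : ℕ} {l' : ℕ → ℝ} {Q' : ℕ → A}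
    (h' : StepApprox f d' N' l' Q') (hN : N' = 2 * N)
    (hl : ∀ k, l' (2 * k) = l k) (hQ : ∀ k, Q' (2 * k + 1) = Q k) :
    ‖stepElement N' l' Q' - stepElement N l Q‖ ≤ d' := by
  subst hN
  have hsum : ∀ (F : ℕ → A) (n : ℕ), ∑ k ∈ range (2 * n), F k =
      ∑ k ∈ range n, (F (2 * k) + F (2 * k + 1)) := by
    intro F n
    induction n with
    | zero => simp
    | succ n ih =>
      rw [mul_add, mul_one, sum_range_succ, sum_range_succ, ih, sum_range_succ, add_assoc]
  have h1 : stepElement (2 * N) l' Q' - stepElement N l Q =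
      ∑ k ∈ range N, (l' (2 * k + 1) - l' (2 * k)) • (Q' (2 * k) - Q' (2 * k + 1)) := by
    rw [stepElement, stepElement, hsum, ← sum_sub_distrib]
    refine sum_congr rfl fun k _ => ?_
    rw [← hl k, ← hl (k + 1), ← hQ k, show 2 * (k + 1) = 2 * k + 1 + 1 by ring]
    simp only [sub_smul, smul_sub]
    abel
  rw [h1]
  refine norm_sum_smul_projections_le (fun k => ?_) (fun i k hik => ?_)
    (c := fun k => l' (2 * k + 1) - l' (2 * k)) (fun k => ?_) (fun k => ?_) N
  · exact isStarProjection_sub_of_mul_eq (h'.proj _) (h'.proj _) (h'.mul _)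
  · rw [mul_sub, sub_mul, sub_mul, h'.mul_of_le (by omega), h'.mul_of_le (by omega),
      h'.mul_of_le (by omega), h'.mul_of_le (by omega)]
    abel
  · exact sub_nonneg.2 (h'.mono _)
  · have := h'.gap (2 * k)
    change l' (2 * k + 1) - l' (2 * k) ≤ d'
    linarith

/-- A new level inside a gap has its class between those of the neighbouring projections, where
cancellation realizes it. Above `Q 0` there is no upper neighbour, and `hext` takes over. -/
theorem exists_refinement (hA : HasCancellation A) (h : StepApprox f d N l Q)
    (hden : ∀ u v : ℝ, 0 < u → u < v → ∃ (t : ℝ) (x : K0.pos A),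
      u ≤ t ∧ t ≤ v ∧ IsLevel f t x)
    (hext : ∀ (t : ℝ) (x : K0.pos A), 0 < t → IsLevel f t x → ∀ (p : A) (hp : IsStarProjection p),
      K0.cls₁ p hp ≤ (x : K0 A) → ∃ (q : A) (hq : IsStarProjection q), p * q = p ∧
        K0.cls₁ q hq = x) :
    ∃ (l' : ℕ → ℝ) (Q' : ℕ → A), StepApprox f (2 / 3 * d) (2 * N) l' Q' ∧
      (∀ k, l' (2 * k) = l k) ∧ ∀ k, Q' (2 * k + 1) = Q k := by
  have hchoice : ∀ k, ∃ (m : ℝ) (R : A) (hR : IsStarProjection R), l k ≤ m ∧ m ≤ l (k + 1) ∧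
      m ≤ l k + 2 / 3 * d ∧ l (k + 1) ≤ m + 2 / 3 * d ∧ Q k * R = Q k ∧
      (∀ i, k = i + 1 → R * Q i = R) ∧ IsLevel f m (K0.posCls₁ R hR) := by
    intro k
    have hg := h.gap k
    -- An empty gap has no room for a new level, so the level `l (k + 1)` and `Q k` are repeated.
    rcases (h.mono k).eq_or_lt with heq | hlt
    · have hd : 0 ≤ d := by linarith
      refine ⟨l (k + 1), Q k, h.proj k, h.mono k, le_rfl, by linarith, by linarith,
        (h.proj k).isIdempotentElem, ?_, h.level k⟩
      rintro i rfl
      exact h.mul i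
    · have hl0 := h.nonneg k
      -- A level in the middle third leaves two gaps of at most `2/3` of the old one.
      obtain ⟨m, x, hum, hmv, hx⟩ := hden (l k + (l (k + 1) - l k) / 3)
        (l k + 2 * (l (k + 1) - l k) / 3) (by linarith) (by linarith)
      have hQx : K0.cls₁ (Q k) (h.proj k) ≤ (x : K0 A) := hx.le_of_lt (h.level k) (by linarith)
      obtain ⟨R, hR, hQR, hRQ, hRx⟩ : ∃ (R : A) (hR : IsStarProjection R), Q k * R = Q k ∧
          (∀ i, k = i + 1 → R * Q i = R) ∧ K0.cls₁ R hR = x := by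
        cases k with
        | zero =>
          obtain ⟨R, hR, h1, h2⟩ := hext m x (by linarith) hx (Q 0) (h.proj 0) hQx
          exact ⟨R, hR, h1, fun i hi => absurd hi (by omega), h2⟩
        | succ i =>
          have hxQ : (x : K0 A) ≤ K0.cls₁ (Q i) (h.proj i) :=
            (h.level i).le_of_lt hx (by linarith)
          obtain ⟨R, hR, h1, h2, h3⟩ := hA.exists_between (h.proj (i + 1)) (h.proj i) (h.mul i)
            hQx hxQ
          refine ⟨R, hR, h1, fun i' hi => ?_, h3⟩
          obtain rfl : i = i' := by omega
          exact h2
      refine ⟨m, R, hR, by linarith, by linarith, by linarith, by linarith, hQR, hRQ, ?_⟩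
      have : K0.posCls₁ R hR = x := Subtype.ext hRx
      rwa [this]
  choose m R hR h1 h2 h3 h4 h5 h6 h7 using hchoice
  -- The levels become `l 0, m 0, l 1, m 1, …` and the projections `R 0, Q 0, R 1, Q 1, …`; the
  -- value `m k` is passed at `[R k]` and `l (k + 1)` at `[Q k]`.
  set l' : ℕ → ℝ := fun n => if n % 2 = 0 then l (n / 2) else m (n / 2) with hl'
  set Q' : ℕ → A := fun n => if n % 2 = 0 then R (n / 2) else Q (n / 2) with hQ'
  have e1 : ∀ k, l' (2 * k) = l k := fun k => by simp [hl']
  have e2 : ∀ k, l' (2 * k + 1) = m k := fun k => by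
    simp only [hl']; rw [if_neg (by omega), show (2 * k + 1) / 2 = k by omega]
  have e3 : ∀ k, l' (2 * k + 1 + 1) = l (k + 1) := fun k => e1 (k + 1)
  have e4 : ∀ k, Q' (2 * k) = R k := fun k => by simp [hQ']
  have e5 : ∀ k, Q' (2 * k + 1) = Q k := fun k => by
    simp only [hQ']; rw [if_neg (by omega), show (2 * k + 1) / 2 = k by omega]
  have e6 : ∀ k, Q' (2 * k + 1 + 1) = R (k + 1) := fun k => e4 (k + 1)
  have hcases : ∀ {P : ℕ → Prop}, (∀ k, P (2 * k)) → (∀ k, P (2 * k + 1)) → ∀ n, P n := by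
    intro P ha hb n
    rcases Nat.even_or_odd' n with ⟨k, rfl | rfl⟩
    · exact ha k
    · exact hb k
  have hproj : ∀ n, IsStarProjection (Q' n) :=
    hcases (fun k => by rw [e4]; exact hR k) (fun k => by rw [e5]; exact h.proj k)
  have hlev : ∀ {t t' : ℝ} {p p' : A} (hp : IsStarProjection p) (hp' : IsStarProjection p'),
      t = t' → p = p' → IsLevel f t' (K0.posCls₁ p' hp') → IsLevel f t (K0.posCls₁ p hp) := by
    rintro t _ p _ hp hp' rfl rfl hl
    exact hl
  refine ⟨l', Q', ⟨Nat.mul_pos two_pos h.pos, ?_, ?_, ?_, ?_, hproj, ?_, ?_, ?_⟩, e1, e5⟩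
  · exact (e1 0).trans h.zero
  · refine hcases (fun k => ?_) (fun k => ?_)
    · rw [e1, e2]; exact h1 k
    · rw [e2, e3]; exact h2 k
  · refine hcases (fun k => ?_) (fun k => ?_)
    · rw [e1, e2]; exact h3 k
    · rw [e2, e3]; exact h4 k
  · refine hcases (fun k hk => ?_) (fun k hk => ?_)
    · rw [e1]; exact h.top k (by omega)
    · rw [e2]
      refine le_antisymm ((h2 k).trans (h.le_top _)) ?_
      rw [← h.top k (by omega)]; exact h1 k
  · refine hcases (fun k => ?_) (fun k => ?_)
    · rw [e4, e5]; exact h5 k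
    · rw [e5, e6]; exact h6 (k + 1) k rfl
  · refine hcases (fun k hk => ?_) (fun k hk => ?_)
    · have hN := h.pos
      obtain ⟨i, rfl⟩ : ∃ i, k = i + 1 := ⟨k - 1, by omega⟩
      rw [e4, ← h6 (i + 1) i rfl, h.bot i (by omega), mul_zero]
    · rw [e5]; exact h.bot k (by omega)
  · refine hcases (fun k => ?_) (fun k => ?_)
    · exact hlev _ _ (e2 k) (e4 k) (h7 k)
    · exact hlev _ _ (e3 k) (e5 k) (h.level k)

theorem constant {f : K0.pos A → ℝ≥0} (hf : Antitone f) :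
    StepApprox f (f 0) 1 (fun k => if k = 0 then 0 else f 0) (0 : ℕ → A) where
  pos := one_pos
  zero := by simp
  mono k := by split_ifs <;> simp_all
  gap k := by split_ifs <;> simp_all
  top k hk := if_neg (by omega)
  proj _ := .zero A
  mul _ := by simp
  bot _ _ := rfl
  level k := by
    have h0 : K0.posCls₁ (0 : A) (.zero A) = 0 := Subtype.ext (K0.cls₁_zero (.zero A))
    change IsLevel f _ (K0.posCls₁ (0 : A) (.zero A))
    rw [h0, if_neg (Nat.succ_ne_zero k)]
    exact ⟨fun y hy => NNReal.coe_le_coe.2 (hf hy), fun y hy => absurd (K0.pos_zero_le y) hy⟩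

end StepApprox

/-- A decreasing function whose levels are dense and are realized by increasing projections is a
singular value function. -/
theorem exists_eq_s (hA : HasCancellation A) {f : K0.pos A → ℝ≥0} (hf : Antitone f)
    (hden : ∀ u v : ℝ, 0 < u → u < v → ∃ (t : ℝ) (x : K0.pos A),
      u ≤ t ∧ t ≤ v ∧ IsLevel f t x)
    (hext : ∀ (t : ℝ) (x : K0.pos A), 0 < t → IsLevel f t x → ∀ (p : A) (hp : IsStarProjection p),
      K0.cls₁ p hp ≤ (x : K0 A) → ∃ (q : A) (hq : IsStarProjection q), p * q = p ∧
        K0.cls₁ q hq = x) :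
    ∃ a : A, f = s a := by
  -- The bound `(2/3)^n f 0` on the gaps is summable, so the step elements form a Cauchy sequence.
  let State (n : ℕ) := {S : (ℕ → ℝ) × (ℕ → A) // StepApprox f ((2 / 3) ^ n * f 0) (2 ^ n) S.1 S.2}
  have hstep : ∀ (n : ℕ) (S : State n), ∃ S' : State (n + 1),
      (∀ k, S'.1.1 (2 * k) = S.1.1 k) ∧ ∀ k, S'.1.2 (2 * k + 1) = S.1.2 k := by
    rintro n ⟨⟨l, Q⟩, h⟩
    obtain ⟨l', Q', h', e1, e2⟩ := h.exists_refinement hA hden hext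
    refine ⟨⟨(l', Q'), ?_⟩, e1, e2⟩
    rw [pow_succ', pow_succ', mul_assoc]
    exact h'
  choose next hn1 hn2 using hstep
  let S : ∀ n, State n := fun n => Nat.rec
    ⟨((fun k => if k = 0 then 0 else (f 0 : ℝ)), 0), by simpa using StepApprox.constant hf⟩ next n
  set a : ℕ → A := fun n => stepElement (2 ^ n) (S n).1.1 (S n).1.2 with ha
  have hdiff : ∀ n, ‖a (n + 1) - a n‖ ≤ (2 / 3) ^ (n + 1) * f 0 := by
    intro n
    exact (S (n + 1)).2.norm_stepElement_sub_le (pow_succ' 2 n) (hn1 n (S n)) (hn2 n (S n))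
  have hcauchy : CauchySeq a := by
    refine cauchySeq_of_le_geometric (2 / 3) (f 0) (by norm_num) fun n => ?_
    rw [dist_comm, dist_eq_norm]
    refine (hdiff n).trans ?_
    rw [pow_succ, mul_comm]
    have : (0 : ℝ) ≤ (2 / 3) ^ n := by positivity
    gcongr
    linarith
  obtain ⟨b, hb⟩ := cauchySeq_tendsto_of_complete hcauchy
  refine ⟨b, funext fun g => NNReal.coe_injective ?_⟩
  have hbound : ∀ n, |(s b g : ℝ) - f g| ≤ 2 * ‖a n - b‖ + (2 / 3) ^ n * f 0 := by
    intro n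
    have h1 := abs_le.1 ((S n).2.abs_s_sub_le g)
    have h2 := s_le_add b (a n) g
    have h3 := s_le_add (a n) b g
    rw [norm_sub_rev] at h2
    simp only [ha] at h2 h3 ⊢
    rw [abs_le]; constructor <;> linarith [h1.1, h1.2]
  have hlim : Tendsto (fun n => 2 * ‖a n - b‖ + (2 / 3 : ℝ) ^ n * f 0) atTop (𝓝 0) := by
    have h1 := (tendsto_iff_norm_sub_tendsto_zero.1 hb).const_mul 2
    have h2 := (tendsto_pow_atTop_nhds_zero_of_lt_one (r := (2 / 3 : ℝ)) (by norm_num)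
      (by norm_num)).mul_const (f 0 : ℝ)
    simpa using h1.add h2
  have h0 : |(s b g : ℝ) - f g| ≤ 0 := ge_of_tendsto' hlim hbound
  exact (sub_eq_zero.1 (abs_nonpos_iff.1 h0)).symm

end Realization

/-! ### Realization in the unital and in the stable case -/

section Main

variable {A : Type*} [NonUnitalCStarAlgebra A]

theorem exists_isLevel_real (j : RealEmbedding A) {f : K0.pos A → ℝ≥0} (hf : Antitone f)
    (hrc : RightCts (j.push f)) (hdp : DP (ext (j.push f)) ⊆ j.cone)
    (hsmall : ∀ u : ℝ≥0, 0 < u → ∃ y, f y < u) {u v : ℝ} (hu : 0 < u) (huv : u < v) :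
    ∃ (t : ℝ) (x : K0.pos A), u ≤ t ∧ t ≤ v ∧ IsLevel f t x := by
  obtain ⟨t, x, h1, h2, h3⟩ := exists_isLevel j hf hrc hdp (u := ⟨u, hu.le⟩)
    (v := ⟨v, (hu.trans huv).le⟩) huv (hsmall _ hu)
  exact ⟨t, x, h1, h2, h3⟩

/-- As `f` vanishes at `[1]`, every positive level is passed at or before `[1]`, so interpolation
between `p` and the unit provides the extension. -/
theorem exists_eq_s_of_isIdentity (hA : HasCancellation A) (j : RealEmbedding A) {e : A}
    (he : IsIdentity e) {f : K0.pos A → ℝ≥0} (hf : Antitone f) (hrc : RightCts (j.push f))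
    (hdp : DP (ext (j.push f)) ⊆ j.cone) (h0 : f (K0.posCls₁ e he.isStarProjection) = 0) :
    ∃ a : A, f = s a := by
  refine exists_eq_s hA hf (fun u v hu huv => exists_isLevel_real j hf hrc hdp
    (fun u hu => ⟨_, h0.trans_lt hu⟩) hu huv) fun t x ht hx p hp hpx => ?_
  have hxe : (x : K0 A) ≤ K0.cls₁ e he.isStarProjection := by
    by_contra hne
    have := hx.2 (K0.posCls₁ e he.isStarProjection) hne
    rw [h0] at this
    exact absurd this (not_le.2 ht)
  obtain ⟨q, hq, h1, -, h2⟩ := hA.exists_between hp he.isStarProjection (he p).2 hpx hxe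
  exact ⟨q, hq, h1, h2⟩

/-- Stability enlarges `p` to any larger class; vanishing at infinity is used only to make `f` take
arbitrarily small values. -/
theorem exists_eq_s_of_isStable (hA : HasCancellation A) (hst : IsStable A) (j : RealEmbedding A)
    {f : K0.pos A → ℝ≥0} (hf : Antitone f) (hrc : RightCts (j.push f))
    (hdp : DP (ext (j.push f)) ⊆ j.cone) (h0 : VanishesAtInfty f) :
    ∃ a : A, f = s a := by
  refine exists_eq_s hA hf (fun u v hu huv => exists_isLevel_real j hf hrc hdp
    (fun u hu => ?_) hu huv) fun t x _ _ p hp hpx => hst.exists_ge hp hpx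
  obtain ⟨x, hx⟩ := h0 u hu
  exact ⟨x, hx x le_rfl⟩

end Main

end SVF

end

theorem mainTheorem3 {A : Type*} [NonUnitalCStarAlgebra A]
    (hcancel : SVF.HasCancellation A)
    (hsimple : SVF.K0.IsSimple A) (htotal : SVF.K0.IsTotallyOrdered A) :
    -- `K_0(A)` embeds into the reals as an ordered group, and for each such embedding:
    Nonempty (SVF.RealEmbedding A) ∧ ∀ j : SVF.RealEmbedding A,
      -- realization, unital case
      (∀ (e : A) (he : SVF.IsIdentity e) (f : SVF.K0.pos A → ℝ≥0), Antitone f →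
        SVF.RightCts (j.push f) → SVF.DP (SVF.ext (j.push f)) ⊆ j.cone →
        f (SVF.K0.posCls₁ e he.isStarProjection) = 0 →
        ∃ a : A, f = SVF.s a) ∧
      -- realization, stable case
      (SVF.IsStable A → ∀ f : SVF.K0.pos A → ℝ≥0, Antitone f →
        SVF.RightCts (j.push f) → SVF.DP (SVF.ext (j.push f)) ⊆ j.cone →
        SVF.VanishesAtInfty f →
        ∃ a : A, f = SVF.s a) ∧
      -- regularity of singular value functions, in the unital and in the stable case
      ((∃ e : A, SVF.IsIdentity e) ∨ SVF.IsStable A → SVF.RealRankZero A → ∀ a : A,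
        SVF.RightCts (j.push (SVF.s a)) ∧ SVF.VanishesAtInfty (SVF.s a) ∧
        SVF.DP (SVF.ext (j.push (SVF.s a))) ⊆ j.cone) := by
  refine ⟨SVF.K0.nonempty_realEmbedding hsimple htotal, fun j => ⟨?_, ?_, ?_⟩⟩
  · intro e he f hf hrc hdp h0
    exact SVF.exists_eq_s_of_isIdentity hcancel j he hf hrc hdp h0
  · intro hst f hf hrc hdp h0
    exact SVF.exists_eq_s_of_isStable hcancel hst j hf hrc hdp h0
  · intro _ hrr a
    exact ⟨hrr.rightCts_s j a, hrr.vanishesAtInfty_s a, hrr.dp_subset j a⟩
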